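/- Let $k$ be a field of characteristic zero. For a $k$-algebra $A$ put $A^e=A\otimes_k A^{\mathrm{op}}$, so that (left) $A^e$-modules are the $k$-symmetric $A$-bimodules. The groups $\mathrm{Ext}^n_{A^e}(A,A^e)$ are computed for the left $A^e$-module structures and carry the $A$-bimodule structure induced by the inner bimodule structure $a(x\otimes y)b=xb\otimes ay$ of $A^e$. An algebra automorphism $g$ of $A$ acts on $\mathrm{Ext}^n_{A^e}(A,A^e)$ by transport of structure ($g$ acting on $A$ and $g\otimes g$ on $A^e$; thus $g\cdot f=(g\otimes g)\circ f\circ g^{-1}$ for $n=0$). We write $A\in VdB(d)$ if $A$ has a resolution by finitely generated projective $A^e$-modules and finite projective dimension over $A^e$, $\mathrm{Ext}^n_{A^e}(A,A^e)=0$ for $n\neq d$, and $\mathrm{Ext}^d_{A^e}(A,A^e)$ is an invertible $A$-bimodule. (1) Let $\lambda\in k$ and let $g$ be an algebra automorphism of $A=k[x]$ with $g(x)=\lambda x$ (so $\lambda\ne0$). Then $\mathrm{Ext}^n_{A^e}(A,A^e)=0$ for $n\neq 1$, and there is an isomorphism of bimodules $e:\mathrm{Ext}^1_{A^e}(A,A^e)\to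 A$ with $e(g\cdot\xi)=\lambda^{-1}g(e(\xi))$ for all $\xi$. Let now $V$ be a finite dimensional $k$-vector space, $d=\dim V$, let $G\subset \mathrm{GL}(V)$ be a finite group, and $A=S(V)$ with the induced action of $G$. Let $\det^{-1}$ be the one-dimensional representation of $G$ on which $g$ acts by $\det(g|_V)^{-1}$. (2) $\mathrm{Ext}^n_{A^e}(A,A^e)=0$ for $n\ne d$, and there is an isomorphism of $A$-bimodules $$\mathrm{Ext}^d_{A^e}(A,A^e)\cong A\otimes_k\det{}^{-1}$$ commuting with the actions of $G$, where $g(a\otimes w)=\det(g|_V)^{-1}\,g(a)\otimes w$. (3) Let $U_A=\mathrm{Ext}^d_{A^e}(A,A^e)$. Then $U_A\cong A$ as $A^e\#G$-modules (that is, by an isomorphism of $A$-bimodules which commutes with the actions of $G$) if and only if $G\subset\mathrm{SL}(V)$. (4) Let $B=S(V)\#G$ be the crossed product, with product $(a\# g)(b\# h)=a\,g(b)\# gh$. Then $B\in VdB(d)$, and its dualizing bimodule $U_B=\mathrm{Ext}^d_{B^e}(B,B^e)$ is isomorphic to $B$ as a $B$-bimodule if and only if $G\subset\mathrm{SL}(V)$.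 -/

import Mathlib

open CategoryTheory TensorProduct MulOpposite
open CategoryTheory.Abelian (Ext)

universe u v w

noncomputable section

namespace HochschildDuality

section Bimodules

variable (k : Type u) [Field k] (A : Type w) [Ring A] [Algebra k A]

/-- The enveloping algebra `A ⊗ Aᵒᵖ`.  Its left modules are the `k`-symmetric `A`-bimodules,
`(a ⊗ op b) • m` being `a m b`. -/
def Env : Type w := A ⊗[k] Aᵐᵒᵖ

instance : Ring (Env k A) := inferInstanceAs (Ring (A ⊗[k] Aᵐᵒᵖ))

instance : Algebra k (Env k A) := inferInstanceAs (Algebra k (A ⊗[k] Aᵐᵒᵖ))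

variable {A} in
/-- The element `a ⊗ op b` of the enveloping algebra. -/
def envTmul (a b : A) : Env k A := a ⊗ₜ[k] op b

theorem env_induction {P : Env k A → Prop} (zero : P 0) (tmul : ∀ a b : A, P (envTmul k a b))
    (add : ∀ r s, P r → P s → P (r + s)) (r : Env k A) : P r :=
  TensorProduct.induction_on r zero (fun a b => tmul a b.unop) add

theorem envTmul_mul (a b a' b' : A) :
    envTmul k a b * envTmul k a' b' = envTmul k (a * a') (b' * b) :=
  Algebra.TensorProduct.tmul_mul_tmul a a' (op b) (op b')

/-- `A` as a bimodule over itself: `(a ⊗ op b) • x = a * x * b`. -/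
instance instModuleEnv : Module (Env k A) A :=
  Module.compHom A (AlgHom.mulLeftRight k A : (A ⊗[k] Aᵐᵒᵖ) →ₐ[k] Module.End k A).toRingHom

theorem envTmul_smul (a b x : A) : envTmul k a b • x = a * x * b :=
  AlgHom.mulLeftRight_apply k A a (op b) x

instance instSMulCommClassEnv : SMulCommClass k (Env k A) A where
  smul_comm c r x :=
    (map_smul ((AlgHom.mulLeftRight k A : (A ⊗[k] Aᵐᵒᵖ) →ₐ[k] Module.End k A) r) c x).symm

/-- The anti-automorphism `a ⊗ op b ↦ b ⊗ op a` of `Env k A`. -/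
def envSwap : Env k A →+* (Env k A)ᵐᵒᵖ :=
  ((Algebra.TensorProduct.opAlgEquiv k k A Aᵐᵒᵖ).toAlgHom.comp
    ((Algebra.TensorProduct.congr AlgEquiv.refl (AlgEquiv.opOp k A)).toAlgHom.comp
      (Algebra.TensorProduct.comm k A Aᵐᵒᵖ).toAlgHom)).toRingHom

theorem envSwap_envTmul (a b : A) : envSwap k A (envTmul k a b) = op (envTmul k b a) := by
  change ((Algebra.TensorProduct.opAlgEquiv k k A Aᵐᵒᵖ).toAlgHom.comp
    ((Algebra.TensorProduct.congr AlgEquiv.refl (AlgEquiv.opOp k A)).toAlgHom.comp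
      (Algebra.TensorProduct.comm k A Aᵐᵒᵖ).toAlgHom)) (a ⊗ₜ[k] op b) = _
  simp
  rfl

/-- Right multiplication by `s` on `Env k A`, an endomorphism of the left `Env k A`-module
`Env k A`. -/
def rightMul (s : Env k A) : ModuleCat.of (Env k A) (Env k A) ⟶ ModuleCat.of (Env k A) (Env k A) :=
  ModuleCat.ofHom (LinearMap.toSpanSingleton (Env k A) (Env k A) s)

theorem rightMul_one : rightMul k A 1 = 𝟙 _ := by
  refine ModuleCat.hom_ext (LinearMap.ext fun x : Env k A => ?_)
  exact mul_one x

theorem rightMul_mul (s t : Env k A) : rightMul k A (s * t) = rightMul k A s ≫ rightMul k A t := by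
  refine ModuleCat.hom_ext (LinearMap.ext fun x : Env k A => ?_)
  exact (mul_assoc x s t).symm

theorem rightMul_add (s t : Env k A) : rightMul k A (s + t) = rightMul k A s + rightMul k A t := by
  refine ModuleCat.hom_ext (LinearMap.ext fun x : Env k A => ?_)
  exact mul_add x s t

theorem rightMul_zero : rightMul k A 0 = 0 := by
  refine ModuleCat.hom_ext (LinearMap.ext fun x : Env k A => ?_)
  exact mul_zero x

/-- `Extⁿ_{Aᵉ}(A, Aᵉ)`, computed for the left `Aᵉ`-module structures. -/
def DualExt (n : ℕ) : Type w :=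
  Ext (ModuleCat.of (Env k A) A) (ModuleCat.of (Env k A) (Env k A)) n

instance (n : ℕ) : AddCommGroup (DualExt k A n) :=
  inferInstanceAs (AddCommGroup
    (Ext (ModuleCat.of (Env k A) A) (ModuleCat.of (Env k A) (Env k A)) n))

/-- The bimodule structure on `Extⁿ_{Aᵉ}(A, Aᵉ)`: it comes from the inner bimodule structure
`a (x ⊗ op y) b = x b ⊗ op (a y)` of the second argument `Aᵉ`, which commutes with the outer one. -/
def dualSMul {n : ℕ} (r : Env k A)
    (ξ : Ext (ModuleCat.of (Env k A) A) (ModuleCat.of (Env k A) (Env k A)) n) :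
    Ext (ModuleCat.of (Env k A) A) (ModuleCat.of (Env k A) (Env k A)) n :=
  ξ.comp (Ext.mk₀ (rightMul k A (envSwap k A r).unop)) (add_zero n)

section

variable {k A} {n : ℕ}

theorem dualSMul_one (ξ : Ext (ModuleCat.of (Env k A) A) (ModuleCat.of (Env k A) (Env k A)) n) :
    dualSMul k A 1 ξ = ξ := by
  rw [dualSMul, map_one, MulOpposite.unop_one, rightMul_one, Ext.comp_mk₀_id]

theorem dualSMul_mul (r s : Env k A)
    (ξ : Ext (ModuleCat.of (Env k A) A) (ModuleCat.of (Env k A) (Env k A)) n) :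
    dualSMul k A (r * s) ξ = dualSMul k A r (dualSMul k A s ξ) := by
  rw [dualSMul, dualSMul, dualSMul, map_mul, MulOpposite.unop_mul, rightMul_mul,
    Ext.comp_assoc_of_third_deg_zero, Ext.mk₀_comp_mk₀]

theorem dualSMul_smul_zero (r : Env k A) :
    dualSMul k A r (0 : Ext (ModuleCat.of (Env k A) A) (ModuleCat.of (Env k A) (Env k A)) n) = 0 :=
  Ext.zero_comp _ _ _ _ _

theorem dualSMul_smul_add (r : Env k A)
    (ξ η : Ext (ModuleCat.of (Env k A) A) (ModuleCat.of (Env k A) (Env k A)) n) :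
    dualSMul k A r (ξ + η) = dualSMul k A r ξ + dualSMul k A r η :=
  Ext.add_comp _ _ _ _

theorem dualSMul_add_smul (r s : Env k A)
    (ξ : Ext (ModuleCat.of (Env k A) A) (ModuleCat.of (Env k A) (Env k A)) n) :
    dualSMul k A (r + s) ξ = dualSMul k A r ξ + dualSMul k A s ξ := by
  rw [dualSMul, dualSMul, dualSMul, map_add, MulOpposite.unop_add, rightMul_add, Ext.mk₀_add,
    Ext.comp_add]

theorem dualSMul_zero_smul (ξ : Ext (ModuleCat.of (Env k A) A) (ModuleCat.of (Env k A) (Env k A)) n) :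
    dualSMul k A 0 ξ = 0 := by
  rw [dualSMul, map_zero, MulOpposite.unop_zero, rightMul_zero, Ext.mk₀_zero, Ext.comp_zero]

end

instance (n : ℕ) : Module (Env k A) (DualExt k A n) where
  smul r ξ := dualSMul k A r ξ
  one_smul ξ := dualSMul_one ξ
  mul_smul r s ξ := dualSMul_mul r s ξ
  smul_zero r := dualSMul_smul_zero r
  smul_add r ξ η := dualSMul_smul_add r ξ η
  add_smul r s ξ := dualSMul_add_smul r s ξ
  zero_smul ξ := dualSMul_zero_smul ξ

end Bimodules

section Automorphisms

variable {R : Type w} [Ring R]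

/-- Restriction of scalars along `σ⁻¹`: `r` acts on the new module as `σ⁻¹ r` on the old one. -/
abbrev twist (σ : R ≃+* R) : ModuleCat.{w} R ⥤ ModuleCat.{w} R :=
  ModuleCat.restrictScalars σ.symm.toRingHom

/-- A `σ`-semilinear automorphism `φ` of `M`, as an isomorphism from the twist of `M` to `M`. -/
def twistIso (σ : R ≃+* R) (M : Type w) [AddCommGroup M] [Module R M] (φ : M ≃+ M)
    (hφ : ∀ (r : R) (m : M), φ (r • m) = σ r • φ m) :
    (twist σ).obj (ModuleCat.of R M) ≅ ModuleCat.of R M :=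
  letI e : (twist σ).obj (ModuleCat.of R M) ≃ₗ[R] M :=
    { φ with
      map_smul' := fun r m => by
        change φ (σ.symm r • (show M from m)) = r • φ m
        rw [hφ, RingEquiv.apply_symm_apply] }
  e.toModuleIso

/-- The map `Extⁿ(M, N) → Extⁿ(M, N)` induced by `σ`-semilinear automorphisms `φ` of `M` and `ψ`
of `N`.  In degree zero it is `f ↦ ψ ∘ f ∘ φ⁻¹`. -/
def extConj (σ : R ≃+* R) (M N : Type w) [AddCommGroup M] [Module R M] [AddCommGroup N] [Module R N]
    (φ : M ≃+ M) (hφ : ∀ (r : R) (m : M), φ (r • m) = σ r • φ m)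
    (ψ : N ≃+ N) (hψ : ∀ (r : R) (x : N), ψ (r • x) = σ r • ψ x) {n : ℕ}
    (ξ : Ext (ModuleCat.of R M) (ModuleCat.of R N) n) :
    Ext (ModuleCat.of R M) (ModuleCat.of R N) n :=
  (Ext.mk₀ (twistIso σ M φ hφ).inv).comp
    ((ξ.mapExactFunctor (twist σ)).comp (Ext.mk₀ (twistIso σ N ψ hψ).hom) (add_zero n)) (zero_add n)

theorem extConj_mk₀ (σ : R ≃+* R) (M N : Type w) [AddCommGroup M] [Module R M] [AddCommGroup N]
    [Module R N] (φ : M ≃+ M) (hφ : ∀ (r : R) (m : M), φ (r • m) = σ r • φ m)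
    (ψ : N ≃+ N) (hψ : ∀ (r : R) (x : N), ψ (r • x) = σ r • ψ x) (f g : M →ₗ[R] N)
    (h : ∀ m, g (φ m) = ψ (f m)) :
    extConj σ M N φ hφ ψ hψ (Ext.mk₀ (ModuleCat.ofHom f)) = Ext.mk₀ (ModuleCat.ofHom g) := by
  rw [extConj, Ext.mapExactFunctor_mk₀, Ext.mk₀_comp_mk₀, Ext.mk₀_comp_mk₀]
  congr 1
  rw [Iso.inv_comp_eq]
  refine ModuleCat.hom_ext (LinearMap.ext fun m : M => ?_)
  exact (h m).symm

variable (k : Type u) [Field k] {A : Type w} [Ring A] [Algebra k A]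

/-- The automorphism `a ⊗ op b ↦ g a ⊗ op (g b)` of `Env k A`. -/
def envAut (g : A ≃ₐ[k] A) : Env k A ≃ₐ[k] Env k A :=
  (Algebra.TensorProduct.congr g (AlgEquiv.op g) : (A ⊗[k] Aᵐᵒᵖ) ≃ₐ[k] (A ⊗[k] Aᵐᵒᵖ))

theorem envAut_envTmul (g : A ≃ₐ[k] A) (a b : A) :
    envAut k g (envTmul k a b) = envTmul k (g a) (g b) :=
  Algebra.TensorProduct.map_tmul _ _ a (op b)

theorem map_env_smul (g : A ≃ₐ[k] A) (r : Env k A) (x : A) :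
    g (r • x) = envAut k g r • g x := by
  induction r using env_induction with
  | zero => rw [map_zero, zero_smul, zero_smul, map_zero]
  | tmul a b => rw [envAut_envTmul, envTmul_smul, envTmul_smul, map_mul, map_mul]
  | add r s hr hs => rw [map_add, add_smul, add_smul, map_add, hr, hs]

/-- The action of an algebra automorphism `g` of `A` on `Extⁿ_{Aᵉ}(A, Aᵉ)`, by transport of
structure: `g` acts on the first argument as `g` and on the second one as `g ⊗ g`. -/
def autAct (g : A ≃ₐ[k] A) {n : ℕ} (ξ : DualExt k A n) : DualExt k A n :=
  extConj (envAut k g).toRingEquiv A (Env k A) g.toRingEquiv.toAddEquiv (map_env_smul k g)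
    (envAut k g).toRingEquiv.toAddEquiv (fun r x => map_mul (envAut k g) r x) ξ

end Automorphisms

section VanDenBergh

variable (k : Type u) [Field k] (A : Type w) [Ring A] [Algebra k A]

/-- The tensor product `M ⊗_A N` of two bimodules (as an abelian group): the quotient of `M ⊗_ℤ N`
by the relations `(m a) ⊗ n = m ⊗ (a n)`. -/
abbrev BalancedTensor (M N : Type w) [AddCommGroup M] [Module (Env k A) M]
    [AddCommGroup N] [Module (Env k A) N] : Type w :=
  (M ⊗[ℤ] N) ⧸ Submodule.span ℤ {t : M ⊗[ℤ] N | ∃ (m : M) (a : A) (n : N),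
    t = (envTmul k 1 a • m) ⊗ₜ[ℤ] n - m ⊗ₜ[ℤ] (envTmul k a 1 • n)}

/-- `M ⊗_A N ≅ A` as bimodules, where `a ((m ⊗ n)) b = (a m) ⊗ (n b)`. -/
def TensorIsoSelf (M N : Type w) [AddCommGroup M] [Module (Env k A) M]
    [AddCommGroup N] [Module (Env k A) N] : Prop :=
  ∃ e : BalancedTensor k A M N ≃+ A, ∀ (a b : A) (m : M) (n : N),
    e (Submodule.Quotient.mk ((envTmul k a 1 • m) ⊗ₜ[ℤ] (envTmul k 1 b • n))) =
      a * e (Submodule.Quotient.mk (m ⊗ₜ[ℤ] n)) * b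

/-- Invertible bimodules. -/
def IsInvertibleBimodule (M : Type w) [AddCommGroup M] [Module (Env k A) M] : Prop :=
  ∃ (N : Type w) (_ : AddCommGroup N) (_ : Module (Env k A) N),
    TensorIsoSelf k A M N ∧ TensorIsoSelf k A N M

/-- The class `VdB(d)` of algebras with Van den Bergh duality in dimension `d`: `A` has a resolution
by finitely generated projective `Aᵉ`-modules and finite projective dimension over `Aᵉ`, and
`Extⁿ_{Aᵉ}(A, Aᵉ)` vanishes for `n ≠ d` and is an invertible bimodule for `n = d`. -/
structure IsVdB (d : ℕ) : Prop where
  resolution : ∃ P : ProjectiveResolution (ModuleCat.of (Env k A) A),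
    ∀ n, Module.Finite (Env k A) (P.complex.X n)
  projectiveDimension : ∃ n, HasProjectiveDimensionLE (ModuleCat.of (Env k A) A) n
  subsingleton_ext : ∀ n, n ≠ d → Subsingleton (DualExt k A n)
  invertible : IsInvertibleBimodule k A (DualExt k A d)

end VanDenBergh

section SymmetricAlgebra

variable (k : Type u) [Field k] (V : Type v) [AddCommGroup V] [Module k V]

/-- The algebra endomorphism of `S(V)` extending a linear endomorphism of `V`. -/
def symMap (f : V →ₗ[k] V) : SymmetricAlgebra k V →ₐ[k] SymmetricAlgebra k V :=
  SymmetricAlgebra.lift (SymmetricAlgebra.ι k V ∘ₗ f)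

theorem symMap_ι (f : V →ₗ[k] V) (x : V) :
    symMap k V f (SymmetricAlgebra.ι k V x) = SymmetricAlgebra.ι k V (f x) := by
  simp [symMap]

theorem symMap_id : symMap k V LinearMap.id = AlgHom.id k _ := by
  apply SymmetricAlgebra.algHom_ext
  ext x
  simp [symMap_ι]

theorem symMap_comp (f g : V →ₗ[k] V) :
    symMap k V (f ∘ₗ g) = (symMap k V f).comp (symMap k V g) := by
  apply SymmetricAlgebra.algHom_ext
  ext x
  simp [symMap_ι]

/-- `GL(V)` acting on `S(V)` by algebra automorphisms. -/
def symAut : (V ≃ₗ[k] V) →* (SymmetricAlgebra k V ≃ₐ[k] SymmetricAlgebra k V) where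
  toFun g := AlgEquiv.ofAlgHom (symMap k V g.toLinearMap) (symMap k V g.symm.toLinearMap)
    (by rw [← symMap_comp, LinearEquiv.comp_symm, symMap_id])
    (by rw [← symMap_comp, LinearEquiv.symm_comp, symMap_id])
  map_one' := by
    ext a
    exact DFunLike.congr_fun (symMap_id k V) a
  map_mul' g h := by
    ext a
    exact DFunLike.congr_fun (symMap_comp k V g.toLinearMap h.toLinearMap) a

theorem symAut_ι (g : V ≃ₗ[k] V) (x : V) :
    symAut k V g (SymmetricAlgebra.ι k V x) = SymmetricAlgebra.ι k V (g x) :=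
  symMap_ι k V g.toLinearMap x

variable {k V}

instance (G : Subgroup (V ≃ₗ[k] V)) : MulSemiringAction G (SymmetricAlgebra k V) :=
  MulSemiringAction.compHom _ ((symAut k V).comp G.subtype)

instance (G : Subgroup (V ≃ₗ[k] V)) : SMulCommClass G k (SymmetricAlgebra k V) where
  smul_comm g c a := map_smul (symAut k V g) c a

theorem subgroup_smul_def (G : Subgroup (V ≃ₗ[k] V)) (g : G) (a : SymmetricAlgebra k V) :
    g • a = symAut k V g a := rfl

/-- The crossed product `S(V) # G`: its elements are sums of `single g a` (that is `a # g`), and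
`(a # g) (b # h) = a (g b) # (g h)`. -/
abbrev CrossedProduct (G : Subgroup (V ≃ₗ[k] V)) : Type (max u v) :=
  SkewMonoidAlgebra (SymmetricAlgebra k V) G

/-- The one-dimensional representation `det⁻¹` of `G`. -/
def detInv (G : Subgroup (V ≃ₗ[k] V)) : Representation k G k :=
  (Algebra.lsmul k k k : k →ₐ[k] Module.End k k).toMonoidHom.comp
    ((Units.coeHom k).comp ((LinearEquiv.det⁻¹ : (V ≃ₗ[k] V) →* kˣ).comp G.subtype))

theorem detInv_apply (G : Subgroup (V ≃ₗ[k] V)) (g : G) (c : k) :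
    detInv G g c = (LinearMap.det (g : V ≃ₗ[k] V).toLinearMap)⁻¹ * c := by
  simp [detInv]

end SymmetricAlgebra

end HochschildDuality

end

open HochschildDuality

/-!
Let `S` be a ring and let `x₁, …, xₙ` be a sequence of commuting elements such that right
multiplication by each of them is injective modulo the left ideal generated by the following ones.
Then `M = S / (S x₁ + ⋯ + S xₙ)` is obtained from `S` by `n` short exact sequences
`0 → M₀ → M₀ → M₀ / M₀ x → 0`, and the product of their classes is an element `η` of `Extⁿ(M, S)`
(`Kos`).  The long exact sequences show that `Ext(M, S)` is concentrated in degree `n` and generated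
by `η` over the right action of `S`; when an anti-automorphism of `S` maps the `xᵢ` to `-xᵢ`, it
carries the annihilator of `η` to the left ideal generated by the `xᵢ` (`Kos.ext_eq`).  These classes
take the place of the Koszul resolution: they are natural (`Kos.naturality`), change their sign when
two elements of the sequence are exchanged (`Kos.swap`), and hence are divided by the determinant
under a linear change of the sequence (`kos_linearEquiv`).

If `A = S(V)` or `A = k[x]`, the elements `v ⊗ 1 - 1 ⊗ v` of `Aᵉ` form such a sequence, with quotient
`A`.  Regularity holds in characteristic zero because the partial derivatives of `A` act on `Aᵉ` as
locally nilpotent operators (`HasPartials.rightReg`).  So `Extᵈ(A, Aᵉ)` is a bimodule with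
the generator `η`, isomorphic to `A`, and an automorphism `g` of `A` that comes from `GL(V)` maps `η`
to `det(g)⁻¹ η` (`HasPartials.dualExt`).  An equivariant isomorphism with `A` would make `η`
correspond to an element of `A` on which `g` acts by `det(g)⁻¹` and whose constant term is not zero,
so that `det(g) = 1`.

For `B = S(V) # G` the elements `v ⊗ 1 - 1 ⊗ v` of `Bᵉ` still form a regular sequence.  The
quotient `X` of `Bᵉ` by the left ideal that they generate is larger than `B`, but `B` is a direct
summand of it: the projection of `X` to `B` followed by the inclusion is induced by right
multiplication by the mean value of the elements `g ⊗ g⁻¹`.  By naturality, right multiplication by `g ⊗ g⁻¹` multiplies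
the Koszul class of `X` by `det(g)⁻¹ (g ⊗ g⁻¹)`.  It follows that `Extᵈ(B, Bᵉ)` is `B`, with
the right action twisted by the automorphism `a # g ↦ det(g) a # g` (`IsCrossed.dualExt`).  A twist
of `B` is an invertible bimodule (`isInvertibleBimodule_of_twist`), and the augmentation `B → k` shows
that this one is isomorphic to `B` only if the determinant is trivial on `G`
(`IsCrossed.nonempty_equiv_iff`).  The algebra `Bᵉ` is Noetherian, being finite over `Aᵉ`, so that `B`
has a resolution by finitely generated projective modules (`exists_finite_projectiveResolution`).
-/

namespace HochschildDuality

/-! ### Koszul classes in Ext of cyclic modules -/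

section Koszul

variable {S : Type w} [Ring S]

variable (S) in
/-- The ring `S` as a left module over itself. -/
abbrev regMod : ModuleCat.{w} S := ModuleCat.of S S

/-- Right multiplication by `s`, an endomorphism of the left module `S`. -/
def mulR (s : S) : regMod S ⟶ regMod S :=
  ModuleCat.ofHom (LinearMap.toSpanSingleton S S s)

theorem hom_apply_eq {N : ModuleCat.{w} S} (φ : regMod S ⟶ N) (s : S) :
    φ.hom s = s • φ.hom (1 : S) := by
  rw [← map_smul]
  exact congrArg φ.hom (mul_one s).symm

theorem mulR_comp (s t : S) : mulR s ≫ mulR t = mulR (s * t) :=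
  ModuleCat.hom_ext (LinearMap.ext fun x : S => mul_assoc x s t)

theorem mulR_comp_assoc {N : ModuleCat.{w} S} (s t : S) (φ : regMod S ⟶ N) :
    mulR s ≫ mulR t ≫ φ = mulR (s * t) ≫ φ := by
  rw [← Category.assoc, mulR_comp]

theorem mulR_one : mulR (1 : S) = 𝟙 _ :=
  ModuleCat.hom_ext (LinearMap.ext fun x : S => mul_one x)

theorem mulR_zero : mulR (0 : S) = 0 :=
  ModuleCat.hom_ext (LinearMap.ext fun x : S => mul_zero x)

theorem mulR_add (s t : S) : mulR (s + t) = mulR s + mulR t :=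
  ModuleCat.hom_ext (LinearMap.ext fun x : S => mul_add x s t)

theorem mulR_neg (s : S) : mulR (-s) = -mulR s :=
  ModuleCat.hom_ext (LinearMap.ext fun x : S => mul_neg x s)

theorem mulR_sum {ι : Type*} (t : Finset ι) (s : ι → S) :
    mulR (∑ i ∈ t, s i) = ∑ i ∈ t, mulR (s i) :=
  map_sum (AddMonoidHom.mk' mulR mulR_add) s t

/-- Every endomorphism of the left module `S` is a right multiplication. -/
theorem eq_mulR (φ : regMod S ⟶ regMod S) : ∃ s : S, φ = mulR s :=
  ⟨φ.hom (1 : S), ModuleCat.hom_ext (LinearMap.ext fun x : S => hom_apply_eq φ x)⟩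

theorem epi_of_surjective {M N : ModuleCat.{w} S} {π : M ⟶ N}
    (hπ : Function.Surjective π.hom) : Epi π :=
  (ModuleCat.epi_iff_surjective π).2 hπ

/-- A map out of `S` factors through an epimorphism `π` as soon as it kills `ker π`. -/
theorem exists_desc {L M N : ModuleCat.{w} S} {π : L ⟶ M} (hπ : Function.Surjective π.hom)
    (φ : L ⟶ N) (h : ∀ s, π.hom s = 0 → φ.hom s = 0) : ∃ f : M ⟶ N, π ≫ f = φ := by
  let e := π.hom.quotKerEquivOfSurjective hπ
  refine ⟨ModuleCat.ofHom (((LinearMap.ker π.hom).liftQ φ.hom h).comp e.symm.toLinearMap),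
    ModuleCat.hom_ext (LinearMap.ext fun s => ?_)⟩
  have : e.symm (π.hom s) = Submodule.Quotient.mk s := by
    rw [LinearEquiv.symm_apply_eq]
    rfl
  change ((LinearMap.ker π.hom).liftQ φ.hom h) (e.symm (π.hom s)) = φ.hom s
  rw [this]
  rfl

/-- `Kos [x₁, …, xₙ] M π n η` says that `M`, with the surjection `π : S → M`, is obtained from `S`
by successively dividing by right multiplication with `xₙ, …, x₁`, each of which is injective, and
that `η ∈ Extⁿ(M, S)` is the product of the classes of the resulting short exact sequences
`0 → M₀ → M₀ → M₀ / M₀ x → 0`.  For the empty list, `η` is the inverse of the isomorphism `π`; the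
composition with an identity only moves it from degree `0 + 0` to degree `n`. -/
def Kos : (l : List S) → (M : ModuleCat.{w} S) → (π : regMod S ⟶ M) → (n : ℕ) →
    Ext M (regMod S) n → Prop
  | [], M, π, n, η => ∃ e : M ⟶ regMod S, π ≫ e = 𝟙 _ ∧ e ≫ π = 𝟙 _ ∧
      ∃ h : 0 + 0 = n, η = (Ext.mk₀ e).comp (Ext.mk₀ (𝟙 (regMod S))) h
  | x :: l, M, π, n, η => ∃ (M₀ : ModuleCat.{w} S) (π₀ : regMod S ⟶ M₀) (m : ℕ)
      (η₀ : Ext M₀ (regMod S) m) (f : M₀ ⟶ M₀) (g : M₀ ⟶ M) (w : f ≫ g = 0)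
      (h : (ShortComplex.mk f g w).ShortExact) (hn : 1 + m = n),
      Kos l M₀ π₀ m η₀ ∧ π₀ ≫ f = mulR x ≫ π₀ ∧ π₀ ≫ g = π ∧ η = h.extClass.comp η₀ hn

theorem mem_ofList_cons {x s : S} {l : List S} :
    s ∈ Ideal.ofList (x :: l) ↔ ∃ t, s - t * x ∈ Ideal.ofList l := by
  rw [Ideal.ofList_cons, Submodule.mem_sup]
  constructor
  · rintro ⟨y, hy, z, hz, rfl⟩
    obtain ⟨t, rfl⟩ := Ideal.mem_span_singleton'.1 hy
    exact ⟨t, by simpa using hz⟩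
  · rintro ⟨t, ht⟩
    exact ⟨t * x, Ideal.mem_span_singleton'.2 ⟨t, rfl⟩, _, ht, by simp⟩

theorem shortExact_mk {L M N : ModuleCat.{w} S} {f : L ⟶ M} {g : M ⟶ N}
    (hf : Function.Injective f.hom) (hg : Function.Surjective g.hom)
    (hfg : ∀ m, g.hom m = 0 ↔ ∃ l, f.hom l = m) :
    ∃ w : f ≫ g = 0, (ShortComplex.mk f g w).ShortExact := by
  have w : f ≫ g = 0 := ModuleCat.hom_ext (LinearMap.ext fun l => (hfg _).2 ⟨l, rfl⟩)
  refine ⟨w, ?_⟩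
  have : Mono f := (ModuleCat.mono_iff_injective f).2 hf
  have : Epi g := epi_of_surjective hg
  exact ⟨(ShortComplex.moduleCat_exact_iff _).2 fun m hm => (hfg m).1 hm⟩

/-- The module of `Kos l M π n η` is `S` modulo the left ideal generated by `l`. -/
theorem Kos.ker {l : List S} {M : ModuleCat.{w} S} {π : regMod S ⟶ M} {n : ℕ}
    {η : Ext M (regMod S) n} (h : Kos l M π n η) :
    Function.Surjective π.hom ∧ ∀ s : S, π.hom s = 0 ↔ s ∈ Ideal.ofList l := by
  induction l generalizing M n with
  | nil =>
    obtain ⟨e, h₁, h₂, -⟩ := h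
    have h₁' : ∀ s : S, e.hom (π.hom s) = s := fun s => congr($(h₁).hom s)
    have h₂' : ∀ s, π.hom (e.hom s) = s := fun s => congr($(h₂).hom s)
    refine ⟨fun m => ⟨_, h₂' m⟩, fun s => ?_⟩
    simp only [Ideal.ofList_nil, Submodule.mem_bot]
    constructor
    · intro h
      rw [← h₁' s, h, map_zero]
    · rintro rfl
      exact map_zero _
  | cons x l ih =>
    obtain ⟨M₀, π₀, m, η₀, f, g, w, h, hn, hk, hf, rfl, -⟩ := h
    obtain ⟨hs, hker⟩ := ih hk
    have hf' : ∀ s : S, f.hom (π₀.hom s) = π₀.hom (s * x) := fun s => congr($(hf).hom s)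
    have hg : Function.Surjective g.hom := (ModuleCat.epi_iff_surjective g).1 h.epi_g
    refine ⟨hg.comp hs, fun s => ?_⟩
    rw [mem_ofList_cons]
    constructor
    · intro h0
      obtain ⟨m, hm⟩ := (ShortComplex.moduleCat_exact_iff _).1 h.exact (π₀.hom s) h0
      obtain ⟨t, rfl⟩ := hs m
      refine ⟨t, (hker _).1 ?_⟩
      rw [map_sub, ← hf', sub_eq_zero]
      exact hm.symm
    · rintro ⟨t, ht⟩
      have := (hker _).2 ht
      rw [map_sub, sub_eq_zero, ← hf'] at this
      have e : (π₀ ≫ g).hom s = g.hom (π₀.hom s) := rfl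
      rw [e, this]
      exact congr($(w).hom (π₀.hom t))

/-- `RightReg [x₁, …, xₙ]` says that right multiplication by `xᵢ` is injective modulo the left ideal
generated by `xᵢ₊₁, …, xₙ`. -/
def RightReg : List S → Prop
  | [] => True
  | x :: l => (∀ s, s * x ∈ Ideal.ofList l → s ∈ Ideal.ofList l) ∧ RightReg l

/-- Right multiplication by `s` maps the left ideal generated by `l₁` to the one generated
by `l₂`, if `xᵢ s = s yᵢ` for the entries `xᵢ` of `l₁` and `yᵢ` of `l₂`. -/
theorem mul_mem_ofList {l₁ l₂ : List S} {s : S}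
    (hl : List.Forall₂ (fun x y => x * s = s * y) l₁ l₂) {t : S} (ht : t ∈ Ideal.ofList l₁) :
    t * s ∈ Ideal.ofList l₂ := by
  induction hl generalizing t with
  | nil =>
    simp only [Ideal.ofList_nil, Submodule.mem_bot] at ht ⊢
    rw [ht, zero_mul]
  | @cons x y l₁ l₂ hxy _ ih =>
    obtain ⟨r, hr⟩ := mem_ofList_cons.1 ht
    refine mem_ofList_cons.2 ⟨r * s, ?_⟩
    have := ih hr
    rwa [sub_mul, mul_assoc r x s, hxy, ← mul_assoc] at this

theorem forall₂_self_of_commute {l : List S} {s : S} (h : ∀ y ∈ l, y * s = s * y) :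
    List.Forall₂ (fun x y => x * s = s * y) l l :=
  List.forall₂_same.2 h

/-- One step in the construction of `Kos`. -/
theorem Kos.exists_cons {l : List S} {x : S} {M₀ M : ModuleCat.{w} S} {π₀ : regMod S ⟶ M₀}
    {π : regMod S ⟶ M} {m n : ℕ} {η₀ : Ext M₀ (regMod S) m} (h : Kos l M₀ π₀ m η₀) (hn : 1 + m = n)
    (hx : ∀ s, s * x ∈ Ideal.ofList l → s ∈ Ideal.ofList l) (hc : ∀ y ∈ l, y * x = x * y)
    (hπ : Function.Surjective π.hom) (hk : ∀ s : S, π.hom s = 0 ↔ s ∈ Ideal.ofList (x :: l)) :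
    ∃ (f : M₀ ⟶ M₀) (g : M₀ ⟶ M) (w : f ≫ g = 0) (h : (ShortComplex.mk f g w).ShortExact),
      π₀ ≫ f = mulR x ≫ π₀ ∧ π₀ ≫ g = π ∧ Kos (x :: l) M π n (h.extClass.comp η₀ hn) := by
  obtain ⟨hs, hker⟩ := h.ker
  obtain ⟨f, hf⟩ := exists_desc hs (mulR x ≫ π₀) fun s h0 =>
    (hker _).2 (mul_mem_ofList (forall₂_self_of_commute hc) ((hker _).1 h0))
  have hf' : ∀ s : S, f.hom (π₀.hom s) = π₀.hom (s * x) := fun s => congr($(hf).hom s)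
  obtain ⟨g, hg⟩ := exists_desc hs π fun s h0 => (hk _).2
    (mem_ofList_cons.2 ⟨0, by rw [zero_mul, sub_zero]; exact (hker _).1 h0⟩)
  have hg' : ∀ s : S, g.hom (π₀.hom s) = π.hom s := fun s => congr($(hg).hom s)
  obtain ⟨w, hex⟩ := shortExact_mk (f := f) (g := g)
    (by
      refine (injective_iff_map_eq_zero f.hom).2 fun a ha => ?_
      obtain ⟨s, rfl⟩ := hs a
      rw [hf', hker] at ha
      exact (hker s).2 (hx _ ha))
    (fun a => by
      obtain ⟨s, rfl⟩ := hπ a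
      exact ⟨_, hg' s⟩)
    (fun a => by
      obtain ⟨s, rfl⟩ := hs a
      rw [hg', hk, mem_ofList_cons]
      constructor
      · rintro ⟨t, ht⟩
        refine ⟨π₀.hom t, ?_⟩
        rw [hf', eq_comm, ← sub_eq_zero, ← map_sub]
        exact (hker _).2 ht
      · rintro ⟨b, hb⟩
        obtain ⟨t, rfl⟩ := hs b
        refine ⟨t, (hker _).1 ?_⟩
        rw [map_sub, ← hf', hb, sub_self])
  exact ⟨f, g, w, hex, hf, hg, M₀, π₀, m, η₀, f, g, w, hex, hn, h, hf, hg, rfl⟩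

/-- `S` modulo the left ideal generated by `l`, as an object of the category of modules. -/
abbrev quotMod (l : List S) : ModuleCat.{w} S := ModuleCat.of S (S ⧸ Ideal.ofList l)

/-- The projection of `S` to its quotient by the left ideal generated by `l`. -/
abbrev quotMk (l : List S) : regMod S ⟶ quotMod l := ModuleCat.ofHom (Ideal.ofList l).mkQ

theorem quotMk_surjective (l : List S) : Function.Surjective (quotMk l).hom :=
  (Ideal.ofList l).mkQ_surjective

theorem quotMk_eq_zero (l : List S) (s : S) : (quotMk l).hom s = 0 ↔ s ∈ Ideal.ofList l :=
  Submodule.Quotient.mk_eq_zero _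

theorem RightReg.exists_kos {l : List S} (hl : RightReg l) (hc : l.Pairwise Commute)
    {M : ModuleCat.{w} S} {π : regMod S ⟶ M} (hπ : Function.Surjective π.hom)
    (hk : ∀ s : S, π.hom s = 0 ↔ s ∈ Ideal.ofList l) :
    ∃ η, Kos l M π l.length η := by
  induction l generalizing M with
  | nil =>
    obtain ⟨e, he⟩ := exists_desc hπ (𝟙 (regMod S)) fun s h0 => by
      simpa using (hk s).1 h0
    have := epi_of_surjective hπ
    refine ⟨_, e, he, ?_, zero_add 0, rfl⟩
    rw [← cancel_epi π, ← Category.assoc, he, Category.id_comp, Category.comp_id]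
  | cons x l ih =>
    rw [List.pairwise_cons] at hc
    obtain ⟨η₀, h₀⟩ := ih hl.2 hc.2 (quotMk_surjective l) (quotMk_eq_zero l)
    obtain ⟨f, g, w, hex, -, -, h⟩ := h₀.exists_cons (n := l.length + 1) (add_comm _ _) hl.1
      (fun y hy => (hc.1 y hy).symm) hπ hk
    exact ⟨_, h⟩

/-- Naturality of the Koszul classes: right multiplication by `s` induces a morphism between all
the short exact sequences that define the two classes. -/
theorem Kos.naturality {l₁ l₂ : List S} {s : S}
    (hl : List.Forall₂ (fun x y => x * s = s * y) l₁ l₂)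
    {M₁ M₂ : ModuleCat.{w} S} {π₁ : regMod S ⟶ M₁} {π₂ : regMod S ⟶ M₂} {n : ℕ}
    {η₁ : Ext M₁ (regMod S) n} {η₂ : Ext M₂ (regMod S) n}
    (h₁ : Kos l₁ M₁ π₁ n η₁) (h₂ : Kos l₂ M₂ π₂ n η₂) {f : M₁ ⟶ M₂}
    (hf : π₁ ≫ f = mulR s ≫ π₂) :
    (Ext.mk₀ f).comp η₂ (zero_add n) = η₁.comp (Ext.mk₀ (mulR s)) (add_zero n) := by
  induction hl generalizing M₁ M₂ n with
  | nil =>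
    obtain ⟨e₁, a₁, b₁, rfl, rfl⟩ := h₁
    obtain ⟨e₂, a₂, b₂, _, rfl⟩ := h₂
    simp only [Ext.mk₀_comp_mk₀, Category.comp_id]
    congr 1
    calc f ≫ e₂ = e₁ ≫ (π₁ ≫ f) ≫ e₂ := by
          rw [Category.assoc, ← Category.assoc, b₁, Category.id_comp]
      _ = e₁ ≫ mulR s := by rw [hf, Category.assoc, a₂, Category.comp_id]
  | @cons x y l₁ l₂ hxy hl ih =>
    obtain ⟨M₁', π₁', m, η₁', f₁, g₁, w₁, ex₁, hn₁, k₁, hf₁, rfl, rfl⟩ := h₁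
    obtain ⟨M₂', π₂', m', η₂', f₂, g₂, w₂, ex₂, hn₂, k₂, hf₂, rfl, rfl⟩ := h₂
    obtain rfl : m = m' := by omega
    obtain ⟨hs₁, hker₁⟩ := k₁.ker
    have := epi_of_surjective hs₁
    obtain ⟨f₀, hf₀⟩ := exists_desc hs₁ (mulR s ≫ π₂') fun t h0 =>
      (k₂.ker.2 _).2 (mul_mem_ofList hl ((hker₁ _).1 h0))
    have sq₁ : f₁ ≫ f₀ = f₀ ≫ f₂ := by
      rw [← cancel_epi π₁', ← Category.assoc, ← Category.assoc, hf₁, hf₀, Category.assoc,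
        Category.assoc, hf₀, hf₂, mulR_comp_assoc, mulR_comp_assoc, hxy]
    have sq₂ : g₁ ≫ f = f₀ ≫ g₂ := by
      rw [← cancel_epi π₁', ← Category.assoc, hf, ← Category.assoc,
        ← Category.assoc π₁', hf₀]
    let F : ShortComplex.mk f₁ g₁ w₁ ⟶ ShortComplex.mk f₂ g₂ w₂ :=
      { τ₁ := f₀, τ₂ := f₀, τ₃ := f, comm₁₂ := sq₁.symm, comm₂₃ := sq₂.symm }
    have nat := ShortComplex.ShortExact.extClass_naturality ex₁ ex₂ F
    have := ih k₁ k₂ hf₀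
    change ex₁.extClass.comp (Ext.mk₀ f₀) _ = (Ext.mk₀ f).comp ex₂.extClass _ at nat
    rw [← Ext.comp_assoc _ _ _ (zero_add 1) hn₁ (by omega), ← nat,
      Ext.comp_assoc _ _ _ (add_zero 1) (zero_add m) (by omega), this,
      Ext.comp_assoc _ _ _ hn₁ (add_zero m) (by omega)]

theorem Kos.unique {l : List S} {M : ModuleCat.{w} S} {π : regMod S ⟶ M} {n : ℕ}
    {η₁ η₂ : Ext M (regMod S) n} (h₁ : Kos l M π n η₁) (h₂ : Kos l M π n η₂) : η₁ = η₂ := by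
  have := Kos.naturality (s := 1) (List.forall₂_same.2 fun x _ => by simp) h₁ h₂ (f := 𝟙 M)
    (by rw [mulR_one, Category.comp_id, Category.id_comp])
  rwa [mulR_one, Ext.mk₀_id_comp, Ext.comp_mk₀_id, eq_comm] at this

theorem Kos.hasProjectiveDimensionLT {l : List S} {M : ModuleCat.{w} S} {π : regMod S ⟶ M} {n : ℕ}
    {η : Ext M (regMod S) n} (h : Kos l M π n η) : HasProjectiveDimensionLT M (n + 1) := by
  induction l generalizing M n with
  | nil =>
    obtain ⟨e, h₁, h₂, rfl, -⟩ := h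
    have : Projective (regMod S) :=
      ModuleCat.projective_of_free (ι := Unit) (Module.Basis.singleton Unit S)
    exact hasProjectiveDimensionLT_of_iso ⟨π, e, h₁, h₂⟩ 1
  | cons x l ih =>
    obtain ⟨M₀, π₀, m, η₀, f, g, w, h, rfl, hk, -⟩ := h
    have := ih hk
    have := h.hasProjectiveDimensionLT_X₃ (m + 1) this
      (hasProjectiveDimensionLT_of_ge _ (m + 1) _ (by omega))
    rwa [add_comm 1 m]

end Koszul

/-! ### Dependence on the order of the sequence -/

section ChangeOfSequence

variable {S : Type w} [Ring S]

/-- Changing the last divisor `x` to `c x` modulo the previous ones, for a central unit `c`,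
multiplies the Koszul class by `c⁻¹`. -/
theorem Kos.scale_head {x x' c c' : S} (hc : ∀ s, c * s = s * c) (hcc : c' * c = 1)
    (hcc' : c * c' = 1)
    {l : List S} (hx : x' - c * x ∈ Ideal.ofList l)
    {M : ModuleCat.{w} S} {π : regMod S ⟶ M} {n : ℕ} {η : Ext M (regMod S) n}
    (h : Kos (x :: l) M π n η) :
    Kos (x' :: l) M π n (η.comp (Ext.mk₀ (mulR c')) (add_zero n)) := by
  obtain ⟨M₀, π₀, m, η₀, f, g, w, ex, hn, k, hf, rfl, rfl⟩ := h
  obtain ⟨hs, hker⟩ := k.ker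
  have := epi_of_surjective hs
  have hf' : ∀ s : S, f.hom (π₀.hom s) = π₀.hom (s * x) := fun s => congr($(hf).hom s)
  -- multiplication by `c` and by its inverse on `M₀`
  have hmul : ∀ a : S, (∀ s, a * s = s * a) → ∃ φ : M₀ ⟶ M₀, π₀ ≫ φ = mulR a ≫ π₀ := fun a ha =>
    exists_desc hs _ fun s h0 => (hker _).2 (by
      change s * a ∈ _
      rw [← ha s]
      exact Ideal.mul_mem_left _ _ ((hker s).1 h0))
  have hc' : ∀ s, c' * s = s * c' := fun s => by
    calc c' * s = c' * s * (c * c') := by rw [hcc', mul_one]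
      _ = c' * (c * s) * c' := by rw [hc s]; simp only [mul_assoc]
      _ = s * c' := by rw [← mul_assoc c', hcc, one_mul]
  obtain ⟨φ, hφ⟩ := hmul c hc
  obtain ⟨ψ, hψ⟩ := hmul c' hc'
  have hφψ : φ ≫ ψ = 𝟙 _ := by
    rw [← cancel_epi π₀, ← Category.assoc, hφ, Category.assoc, hψ, mulR_comp_assoc, hcc', mulR_one,
      Category.id_comp, Category.comp_id]
  have hψφ : ψ ≫ φ = 𝟙 _ := by
    rw [← cancel_epi π₀, ← Category.assoc, hψ, Category.assoc, hφ, mulR_comp_assoc, hcc, mulR_one,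
      Category.id_comp, Category.comp_id]
  have hψf : ψ ≫ f = f ≫ ψ := by
    rw [← cancel_epi π₀, ← Category.assoc, ← Category.assoc, hψ, hf, Category.assoc, Category.assoc,
      hψ, hf, mulR_comp_assoc, mulR_comp_assoc, hc']
  -- right multiplication by `x'` on `M₀` is `c` times right multiplication by `x`
  have hx' : π₀ ≫ φ ≫ f = mulR x' ≫ π₀ := by
    refine ModuleCat.hom_ext (LinearMap.ext fun s : S => ?_)
    have e : π₀.hom (s * c * x) = π₀.hom (s * x') := by
      rw [eq_comm, ← sub_eq_zero, ← map_sub, hker, mul_assoc, ← mul_sub]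
      exact Ideal.mul_mem_left _ _ hx
    rw [← Category.assoc, hφ]
    exact (hf' _).trans e
  have w' : (φ ≫ f) ≫ g = 0 := by rw [Category.assoc, w, Limits.comp_zero]
  let e : ShortComplex.mk (φ ≫ f) g w' ≅ ShortComplex.mk f g w :=
    ShortComplex.isoMk ⟨φ, ψ, hφψ, hψφ⟩ (Iso.refl M₀) (Iso.refl M) (by simp) (by simp)
  have ex' : (ShortComplex.mk (φ ≫ f) g w').ShortExact := ShortComplex.shortExact_of_iso e.symm ex
  refine ⟨M₀, π₀, m, η₀, φ ≫ f, g, w', ex', hn, k, hx', rfl, ?_⟩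
  have nat := ShortComplex.ShortExact.extClass_naturality ex' ex e.hom
  change ex'.extClass.comp (Ext.mk₀ φ) _ = (Ext.mk₀ (𝟙 M)).comp ex.extClass _ at nat
  rw [Ext.mk₀_id_comp] at nat
  have nη := Kos.naturality (forall₂_self_of_commute fun y _ => (hc' y).symm) k k hψ
  rw [Ext.comp_assoc _ _ _ hn (add_zero m) (by omega), ← nη, ← nat,
    Ext.comp_assoc _ _ _ (add_zero 1) (zero_add m) (by omega), Ext.mk₀_comp_mk₀_assoc, hφψ,
    Ext.mk₀_id_comp]

/-- Exchanging the last two divisors changes the sign of the Koszul class.  Both products of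
extension classes are computed by the exact sequence `0 → M₀ → M₀² → M₀ → M → 0`, and the exchange
of the two summands of `M₀²` accounts for the sign. -/
theorem Kos.swap {x y : S} {l : List S} (hxy : x * y = y * x) (hx : ∀ z ∈ l, z * x = x * z)
    (hy : ∀ z ∈ l, z * y = y * z)
    (hyr : ∀ s, s * y ∈ Ideal.ofList l → s ∈ Ideal.ofList l)
    (hxr : ∀ s, s * x ∈ Ideal.ofList (y :: l) → s ∈ Ideal.ofList (y :: l))
    {M : ModuleCat.{w} S} {π : regMod S ⟶ M} {n : ℕ} {η : Ext M (regMod S) n}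
    (h : Kos (y :: x :: l) M π n η) : Kos (x :: y :: l) M π n (-η) := by
  obtain ⟨Mx, πx, m₁, ηx, fy, gy, wy, exy, hn, ⟨M₀, π₀, m, η₀, fx, gx, wx, exx, hm, k, hfx, hgx, rfl⟩,
    hfy, hgy, rfl⟩ := id h
  obtain ⟨hs, hker⟩ := k.ker
  obtain ⟨hπ, hkerM⟩ := h.ker
  have hepi := epi_of_surjective hs
  have hkerM' : ∀ s : S, π.hom s = 0 ↔ s ∈ Ideal.ofList (x :: y :: l) := fun s => by
    rw [hkerM, Ideal.ofList_cons, Ideal.ofList_cons, Ideal.ofList_cons, Ideal.ofList_cons,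
      sup_left_comm]
  obtain ⟨fy', gy', wy', exy', hfy', hgy', k'⟩ := k.exists_cons (n := m₁) hm hyr hy
    (quotMk_surjective (y :: l)) (quotMk_eq_zero _)
  obtain ⟨fx', gx', wx', exx', hfx', hgx', k''⟩ := k'.exists_cons hn hxr
    (by simpa [hxy] using hx) hπ hkerM'
  convert k'' using 1
  -- the module `M₀` with its commuting endomorphisms `fx` and `fy'`
  have px : Function.Injective fx.hom := (ModuleCat.mono_iff_injective fx).1 exx.mono_f
  have qx : ∀ a, gx.hom a = 0 ↔ ∃ b, fx.hom b = a := fun a =>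
    ⟨fun h0 => (ShortComplex.moduleCat_exact_iff _).1 exx.exact a h0,
      fun ⟨b, hb⟩ => hb ▸ congr($(wx).hom b)⟩
  have qy : ∀ a, gy'.hom a = 0 ↔ ∃ b, fy'.hom b = a := fun a =>
    ⟨fun h0 => (ShortComplex.moduleCat_exact_iff _).1 exy'.exact a h0,
      fun ⟨b, hb⟩ => hb ▸ congr($(wy').hom b)⟩
  have qyx : ∀ a, gy.hom a = 0 ↔ ∃ b, fy.hom b = a := fun a =>
    ⟨fun h0 => (ShortComplex.moduleCat_exact_iff _).1 exy.exact a h0,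
      fun ⟨b, hb⟩ => hb ▸ congr($(wy).hom b)⟩
  have pyx : Function.Injective fy.hom := (ModuleCat.mono_iff_injective fy).1 exy.mono_f
  have hfx0 : ∀ s : S, fx.hom (π₀.hom s) = π₀.hom (s * x) := fun s => congr($(hfx).hom s)
  have hfy0 : ∀ s : S, fy'.hom (π₀.hom s) = π₀.hom (s * y) := fun s => congr($(hfy').hom s)
  have hcomm : ∀ a, fx.hom (fy'.hom a) = fy'.hom (fx.hom a) := fun a => by
    obtain ⟨s, rfl⟩ := hs a
    rw [hfx0, hfy0, hfy0, hfx0, mul_assoc, mul_assoc, hxy]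
  have hgx_fy : fy' ≫ gx = gx ≫ fy := by
    rw [← cancel_epi π₀, ← Category.assoc, ← Category.assoc, hfy', hgx, hfy, Category.assoc, hgx]
  have hgx_fy' : ∀ a, gx.hom (fy'.hom a) = fy.hom (gx.hom a) := fun a => congr($(hgx_fy).hom a)
  have hgy_fx : fx ≫ gy' = gy' ≫ fx' := by
    rw [← cancel_epi π₀, ← Category.assoc, ← Category.assoc, hfx, hgy', hfx', Category.assoc, hgy']
  have hgxgy : gx ≫ gy = gy' ≫ gx' := by
    rw [← cancel_epi π₀, ← Category.assoc, ← Category.assoc, hgx, hgy, hgy', hgx']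
  have sgx : Function.Surjective gx.hom := (ModuleCat.epi_iff_surjective gx).1 exx.epi_g
  have sgy : Function.Surjective gy.hom := (ModuleCat.epi_iff_surjective gy).1 exy.epi_g
  -- the submodule `K = M₀ x + M₀ y`
  let K : Submodule S M₀ := LinearMap.ker (gx ≫ gy).hom
  have hK : ∀ a, a ∈ K ↔ ∃ b c, a = fx.hom b + fy'.hom c := fun a => by
    have e : a ∈ K ↔ gy.hom (gx.hom a) = 0 := Iff.rfl
    rw [e, qyx]
    constructor
    · rintro ⟨b, hb⟩
      obtain ⟨c, rfl⟩ := sgx b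
      rw [← hgx_fy', eq_comm, ← sub_eq_zero, ← map_sub, qx] at hb
      obtain ⟨b, hb⟩ := hb
      exact ⟨b, c, by rw [hb, sub_add_cancel]⟩
    · rintro ⟨b, c, rfl⟩
      exact ⟨gx.hom c, by rw [map_add, hgx_fy', (qx _).2 ⟨b, rfl⟩, zero_add]⟩
  let ι : ModuleCat.of S K ⟶ M₀ := ModuleCat.ofHom K.subtype
  obtain ⟨wK, exK⟩ := shortExact_mk (f := ι) (g := gx ≫ gy) Subtype.val_injective
    (sgy.comp sgx) (fun a => ⟨fun h0 => ⟨⟨a, h0⟩, rfl⟩, fun ⟨b, hb⟩ => hb ▸ b.2⟩)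
  -- the resolution `0 → M₀ → M₀² → K → 0`
  let i : M₀ ⟶ ModuleCat.of S (M₀ × M₀) := ModuleCat.ofHom (LinearMap.prod (-fy'.hom) fx.hom)
  let p : ModuleCat.of S (M₀ × M₀) ⟶ ModuleCat.of S K := ModuleCat.ofHom
    (LinearMap.codRestrict K (LinearMap.coprod fx.hom fy'.hom)
      fun b => (hK _).2 ⟨b.1, b.2, rfl⟩)
  have hp : ∀ b : M₀ × M₀, ((p.hom b : K) : M₀) = fx.hom b.1 + fy'.hom b.2 := fun b => rfl
  have hex : ∀ b : M₀ × M₀, p.hom b = 0 ↔ ∃ c, i.hom c = b := by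
    rintro ⟨b, c⟩
    rw [← Subtype.coe_inj, hp]
    change fx.hom b + fy'.hom c = 0 ↔ ∃ d, ((-fy'.hom d, fx.hom d) : M₀ × M₀) = (b, c)
    constructor
    · intro h0
      have h1 : gx.hom c = 0 := by
        refine (injective_iff_map_eq_zero fy.hom).1 pyx _ ?_
        have h2 : fy'.hom c = fx.hom (-b) := by
          rw [map_neg]
          exact eq_neg_of_add_eq_zero_right h0
        rw [← hgx_fy', h2]
        exact (qx _).2 ⟨_, rfl⟩
      obtain ⟨d, rfl⟩ := (qx _).1 h1
      refine ⟨d, Prod.ext (px ?_) rfl⟩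
      change fx.hom (-fy'.hom d) = fx.hom b
      rw [map_neg, hcomm]
      exact (eq_neg_of_add_eq_zero_left h0).symm
    · rintro ⟨d, hd⟩
      obtain ⟨rfl, rfl⟩ := Prod.mk.inj hd
      rw [map_neg, hcomm, neg_add_cancel]
  obtain ⟨wp, exp⟩ := shortExact_mk (f := i) (g := p)
    (fun a b hab => px (Prod.mk.inj hab).2)
    (fun a => by
      obtain ⟨b, c, h0⟩ := (hK _).1 a.2
      exact ⟨(b, c), Subtype.ext h0.symm⟩)
    hex
  have sp : Function.Surjective p.hom := (ModuleCat.epi_iff_surjective p).1 exp.epi_g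
  -- the two projections of the resolution to the defining sequences
  obtain ⟨q, hq⟩ := exists_desc sp (ModuleCat.ofHom (LinearMap.snd S M₀ M₀) ≫ gx) (fun b hb => by
    obtain ⟨c, rfl⟩ := (hex b).1 hb
    exact (qx _).2 ⟨c, rfl⟩)
  have hq' : ∀ b : M₀ × M₀, q.hom (p.hom b) = gx.hom b.2 := fun b => congr($(hq).hom b)
  obtain ⟨r, hr⟩ := exists_desc sp (ModuleCat.ofHom (LinearMap.fst S M₀ M₀) ≫ gy') (fun b hb => by
    obtain ⟨c, rfl⟩ := (hex b).1 hb
    exact (qy _).2 ⟨-c, map_neg _ _⟩)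
  have hr' : ∀ b : M₀ × M₀, r.hom (p.hom b) = gy'.hom b.1 := fun b => congr($(hr).hom b)
  let Fq : ShortComplex.mk i p wp ⟶ ShortComplex.mk fx gx wx :=
    { τ₁ := 𝟙 M₀
      τ₂ := ModuleCat.ofHom (LinearMap.snd S M₀ M₀)
      τ₃ := q
      comm₁₂ := rfl
      comm₂₃ := hq.symm }
  let Fr : ShortComplex.mk i p wp ⟶ ShortComplex.mk fy' gy' wy' :=
    { τ₁ := -𝟙 M₀
      τ₂ := ModuleCat.ofHom (LinearMap.fst S M₀ M₀)
      τ₃ := r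
      comm₁₂ := by
        refine ModuleCat.hom_ext (LinearMap.ext fun a => ?_)
        exact map_neg fy'.hom a
      comm₂₃ := hr.symm }
  let Gq : ShortComplex.mk ι (gx ≫ gy) wK ⟶ ShortComplex.mk fy gy wy :=
    { τ₁ := q
      τ₂ := gx
      τ₃ := 𝟙 M
      comm₁₂ := by
        refine ModuleCat.hom_ext (LinearMap.ext fun a => ?_)
        obtain ⟨b, rfl⟩ := sp a
        change fy.hom (q.hom (p.hom b)) = gx.hom (fx.hom b.1 + fy'.hom b.2)
        rw [hq', map_add, hgx_fy', (qx _).2 ⟨_, rfl⟩, zero_add]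
      comm₂₃ := by rw [Category.comp_id] }
  let Gr : ShortComplex.mk ι (gx ≫ gy) wK ⟶ ShortComplex.mk fx' gx' wx' :=
    { τ₁ := r
      τ₂ := gy'
      τ₃ := 𝟙 M
      comm₁₂ := by
        refine ModuleCat.hom_ext (LinearMap.ext fun a => ?_)
        obtain ⟨b, rfl⟩ := sp a
        change fx'.hom (r.hom (p.hom b)) = gy'.hom (fx.hom b.1 + fy'.hom b.2)
        rw [hr', map_add, (qy _).2 ⟨_, rfl⟩, add_zero]
        exact congr($(hgy_fx).hom b.1).symm
      comm₂₃ := by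
        change gy' ≫ gx' = (gx ≫ gy) ≫ 𝟙 M
        rw [Category.comp_id, hgxgy] }
  have n₁ := ShortComplex.ShortExact.extClass_naturality exp exx Fq
  have n₂ := ShortComplex.ShortExact.extClass_naturality exp exy' Fr
  have n₃ := ShortComplex.ShortExact.extClass_naturality exK exy Gq
  have n₄ := ShortComplex.ShortExact.extClass_naturality exK exx' Gr
  change exp.extClass.comp (Ext.mk₀ (𝟙 M₀)) _ = (Ext.mk₀ q).comp exx.extClass _ at n₁
  change exp.extClass.comp (Ext.mk₀ (-𝟙 M₀)) _ = (Ext.mk₀ r).comp exy'.extClass _ at n₂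
  change exK.extClass.comp (Ext.mk₀ q) _ = (Ext.mk₀ (𝟙 M)).comp exy.extClass _ at n₃
  change exK.extClass.comp (Ext.mk₀ r) _ = (Ext.mk₀ (𝟙 M)).comp exx'.extClass _ at n₄
  rw [Ext.mk₀_id_comp] at n₃ n₄
  rw [Ext.comp_mk₀_id] at n₁
  rw [Ext.mk₀_neg, Ext.comp_neg, Ext.comp_mk₀_id] at n₂
  have e₁ : exy.extClass.comp exx.extClass (rfl : 1 + 1 = 2) = exK.extClass.comp exp.extClass rfl := by
    rw [← n₃, Ext.comp_assoc _ _ _ (add_zero 1) (zero_add 1) (by omega), ← n₁]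
  have e₂ : exx'.extClass.comp exy'.extClass (rfl : 1 + 1 = 2) =
      -exK.extClass.comp exp.extClass rfl := by
    rw [← n₄, Ext.comp_assoc _ _ _ (add_zero 1) (zero_add 1) (by omega), ← n₂, Ext.comp_neg]
  rw [← Ext.comp_assoc _ _ _ (rfl : 1 + 1 = 2) hm (by omega), e₁,
    ← Ext.comp_assoc _ _ _ (rfl : 1 + 1 = 2) hm (by omega), e₂, Ext.neg_comp]

end ChangeOfSequence

/-! ### Computation of Ext and transport of structure -/

section RightAction

variable {S : Type w} [Ring S] {M : ModuleCat.{w} S} {n : ℕ}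

/-- The right action of `S` on `Extⁿ(M, S)`. -/
noncomputable def extMulR (η : Ext M (regMod S) n) (s : S) : Ext M (regMod S) n :=
  η.comp (Ext.mk₀ (mulR s)) (add_zero n)

theorem extMulR_extMulR (η : Ext M (regMod S) n) (s t : S) :
    extMulR (extMulR η s) t = extMulR η (s * t) := by
  rw [extMulR, extMulR, extMulR, Ext.comp_assoc_of_third_deg_zero, Ext.mk₀_comp_mk₀, mulR_comp]

theorem extMulR_one (η : Ext M (regMod S) n) : extMulR η 1 = η := by
  rw [extMulR, mulR_one, Ext.comp_mk₀_id]

theorem extMulR_add (η : Ext M (regMod S) n) (s t : S) :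
    extMulR η (s + t) = extMulR η s + extMulR η t := by
  rw [extMulR, extMulR, extMulR, mulR_add, Ext.mk₀_add, Ext.comp_add]

theorem extMulR_neg (η : Ext M (regMod S) n) (s : S) :
    extMulR η (-s) = -extMulR η s := by
  rw [extMulR, extMulR, mulR_neg, Ext.mk₀_neg, Ext.comp_neg]

theorem extMulR_sum {ι : Type*} [Fintype ι] (η : Ext M (regMod S) n) (s : ι → S) :
    extMulR η (∑ i, s i) = ∑ i, extMulR η (s i) := by
  simp only [extMulR, mulR_sum, Ext.mk₀_sum, Ext.comp_sum]

theorem comp_extMulR {N : ModuleCat.{w} S} {a b : ℕ} (α : Ext N M a) (η : Ext M (regMod S) n)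
    (h : a + n = b) (s : S) : α.comp (extMulR η s) h = extMulR (α.comp η h) s :=
  (Ext.comp_assoc _ _ _ h (add_zero n) (by omega)).symm

end RightAction

section Computation

variable {S : Type w} [Ring S] (ω : S →+* Sᵐᵒᵖ)

/-- If `l` is a right regular sequence of commuting elements, then `Ext^m(S / S l, S)` vanishes for
`m ≠ n`, and for `m = n` it is generated by the Koszul class `η`.  The annihilator of `η` is
described by means of an anti-automorphism `ω` of `S` that changes the sign of the entries
of `l`, so that no left regularity needs to be assumed. -/
theorem Kos.ext_eq (hω : Function.Bijective ω) {l : List S} (hreg : RightReg l)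
    (hc : l.Pairwise Commute) (hl : ∀ x ∈ l, ω x = op (-x))
    {M : ModuleCat.{w} S} {π : regMod S ⟶ M} {n : ℕ} {η : Ext M (regMod S) n}
    (h : Kos l M π n η) :
    (∀ m, m ≠ n → ∀ ξ : Ext M (regMod S) m, ξ = 0) ∧
    (∀ ξ : Ext M (regMod S) n, ∃ r, ξ = extMulR η (ω r).unop) ∧
    ∀ r, extMulR η (ω r).unop = 0 ↔ r ∈ Ideal.ofList l := by
  induction l generalizing M n with
  | nil =>
    obtain ⟨e, h₁, h₂, rfl, rfl⟩ := h
    have : Projective (regMod S) :=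
      ModuleCat.projective_of_free (ι := Unit) (Module.Basis.singleton Unit S)
    have hpd := hasProjectiveDimensionLT_of_iso ⟨π, e, h₁, h₂⟩ 1
    refine ⟨fun m hm ξ => ξ.eq_zero_of_hasProjectiveDimensionLT 1 (by omega), fun ξ => ?_,
      fun r => ?_⟩
    · obtain ⟨f, rfl⟩ := (Ext.mk₀_bijective _ _).2 ξ
      obtain ⟨s, hs⟩ := eq_mulR (π ≫ f)
      obtain ⟨r, hr⟩ := hω.2 (op s)
      refine ⟨r, ?_⟩
      rw [hr, extMulR, Ext.mk₀_comp_mk₀, Ext.mk₀_comp_mk₀, Category.comp_id, unop_op, ← hs,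
        ← Category.assoc, h₂, Category.id_comp]
    · rw [extMulR, Ext.mk₀_comp_mk₀, Ext.mk₀_comp_mk₀, Category.comp_id, Ext.mk₀_eq_zero_iff,
        Ideal.ofList_nil, Submodule.mem_bot]
      constructor
      · intro h0
        have : mulR (ω r).unop = 0 := by
          rw [← Category.id_comp (mulR _), ← h₁, Category.assoc, h0, Limits.comp_zero]
        have : (1 : S) * (ω r).unop = 0 := congr($(this).hom (1 : S))
        rw [one_mul, unop_eq_zero_iff] at this
        exact hω.1 (this.trans (map_zero ω).symm)
      · rintro rfl
        rw [map_zero, MulOpposite.unop_zero, mulR_zero, Limits.comp_zero]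
  | cons x l ih =>
    obtain ⟨M₀, π₀, m, η₀, f, g, w, ex, hn, k, hf, rfl, rfl⟩ := h
    rw [List.pairwise_cons] at hc
    obtain ⟨ha, hb, hann⟩ := ih hreg.2 hc.2 (fun y hy => hl y (List.mem_cons_of_mem _ hy)) k
    -- the effect of `f` on `Extᵐ(M₀, S)`
    have nat := Kos.naturality (forall₂_self_of_commute fun y hy => (hc.1 y hy).symm) k k hf
    have hfr : ∀ r, (Ext.mk₀ f).comp (extMulR η₀ (ω r).unop) (zero_add m) =
        -extMulR η₀ (ω (r * x)).unop := fun r => by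
      rw [comp_extMulR, nat]
      change extMulR (extMulR η₀ x) _ = _
      rw [extMulR_extMulR, map_mul, hl x List.mem_cons_self, MulOpposite.unop_mul, unop_op, neg_mul,
        extMulR_neg, neg_neg]
    have hinj : ∀ p (ξ : Ext M₀ (regMod S) p), (Ext.mk₀ f).comp ξ (zero_add p) = 0 → ξ = 0 := by
      intro p ξ h0
      by_cases hp : p = m
      · subst hp
        obtain ⟨r, rfl⟩ := hb ξ
        rw [hfr, neg_eq_zero, hann] at h0
        exact (hann r).2 (hreg.1 r h0)
      · exact ha p hp ξ
    have hg : ∀ p (ξ : Ext M (regMod S) p), (Ext.mk₀ g).comp ξ (zero_add p) = 0 := fun p ξ =>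
      hinj p _ (by rw [Ext.mk₀_comp_mk₀_assoc, w, Ext.mk₀_zero, Ext.zero_comp])
    have hδ : ∀ s, extMulR (ex.extClass.comp η₀ hn) s = ex.extClass.comp (extMulR η₀ s) hn :=
      fun s => (comp_extMulR _ _ _ _).symm
    refine ⟨fun p hp ξ => ?_, fun ξ => ?_, fun r => ?_⟩
    · cases p with
      | zero =>
        obtain ⟨φ, rfl⟩ := (Ext.mk₀_bijective _ _).2 ξ
        have := hg 0 (Ext.mk₀ φ)
        have hepi : Epi g := ex.epi_g
        rw [Ext.mk₀_comp_mk₀, Ext.mk₀_eq_zero_iff] at this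
        rw [Ext.mk₀_eq_zero_iff, ← cancel_epi g, this, Limits.comp_zero]
      | succ p =>
        obtain ⟨ζ, rfl⟩ := Ext.contravariant_sequence_exact₃ ex _ ξ (hg _ ξ) (add_comm 1 p)
        rw [ha p (by omega) ζ]
        exact Ext.comp_zero _ _ _ _ _
    · obtain ⟨ζ, rfl⟩ := Ext.contravariant_sequence_exact₃ ex _ ξ (hg _ ξ) hn
      obtain ⟨r, rfl⟩ := hb ζ
      exact ⟨r, (hδ _).symm⟩
    · rw [hδ, mem_ofList_cons]
      constructor
      · intro h0
        obtain ⟨ζ, hζ⟩ := Ext.contravariant_sequence_exact₁ ex _ _ hn h0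
        obtain ⟨t, rfl⟩ := hb ζ
        change (Ext.mk₀ f).comp _ _ = _ at hζ
        refine ⟨-t, (hann _).1 ?_⟩
        rw [neg_mul, sub_neg_eq_add, map_add, MulOpposite.unop_add, extMulR_add, ← hζ, hfr, neg_add_cancel]
      · rintro ⟨t, ht⟩
        have h0 := (hann _).2 ht
        have := hfr (-t)
        rw [neg_mul, map_neg ω (t * x), MulOpposite.unop_neg, extMulR_neg, neg_neg] at this
        rw [map_sub, MulOpposite.unop_sub, sub_eq_add_neg, extMulR_add, extMulR_neg, ← this,
          ← sub_eq_add_neg, sub_eq_zero] at h0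
        rw [h0]
        exact ShortComplex.ShortExact.extClass_comp_assoc ex _

end Computation

section Twist

variable {S : Type w} [Ring S]

/-- The Koszul classes are compatible with isomorphisms of modules. -/
theorem Kos.of_iso {l : List S} {M M' : ModuleCat.{w} S} {π : regMod S ⟶ M} {n : ℕ}
    {η : Ext M (regMod S) n} (h : Kos l M π n η) (i : M ≅ M') :
    Kos l M' (π ≫ i.hom) n ((Ext.mk₀ i.inv).comp η (zero_add n)) := by
  cases l with
  | nil =>
    obtain ⟨e, h₁, h₂, rfl, rfl⟩ := h
    refine ⟨i.inv ≫ e, by simpa using h₁, ?_, rfl, by simp⟩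
    rw [Category.assoc, reassoc_of% h₂, i.inv_hom_id]
  | cons x l =>
    obtain ⟨M₀, π₀, m, η₀, f, g, w, ex, hn, k, hf, rfl, rfl⟩ := h
    have w' : f ≫ g ≫ i.hom = 0 := by rw [reassoc_of% w, Limits.zero_comp]
    let e : ShortComplex.mk f g w ≅ ShortComplex.mk f (g ≫ i.hom) w' :=
      ShortComplex.isoMk (Iso.refl _) (Iso.refl _) i (by simp) (by simp)
    have ex' : (ShortComplex.mk f (g ≫ i.hom) w').ShortExact := ShortComplex.shortExact_of_iso e ex
    refine ⟨M₀, π₀, m, η₀, f, g ≫ i.hom, w', ex', hn, k, hf, by rw [Category.assoc], ?_⟩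
    have nat := ShortComplex.ShortExact.extClass_naturality ex' ex e.inv
    change ex'.extClass.comp (Ext.mk₀ (𝟙 M₀)) _ = (Ext.mk₀ i.inv).comp ex.extClass _ at nat
    rw [Ext.comp_mk₀_id] at nat
    rw [nat, Ext.comp_assoc _ _ _ (zero_add 1) hn (by omega)]

variable (σ : S ≃+* S)

/-- The isomorphism from the twist of `S` by `σ` to `S` that is given by `σ`. -/
noncomputable abbrev twistReg : (twist σ).obj (regMod S) ≅ regMod S :=
  twistIso σ S σ.toAddEquiv (fun r x => map_mul σ r x)

theorem Kos.map_twist {l : List S} {M : ModuleCat.{w} S} {π : regMod S ⟶ M} {n : ℕ}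
    {η : Ext M (regMod S) n} (h : Kos l M π n η) :
    Kos (l.map σ) ((twist σ).obj M) ((twistReg σ).inv ≫ (twist σ).map π) n
      ((η.mapExactFunctor (twist σ)).comp (Ext.mk₀ (twistReg σ).hom)
        (add_zero n)) := by
  induction l generalizing M n with
  | nil =>
    obtain ⟨e, h₁, h₂, rfl, rfl⟩ := h
    refine ⟨(twist σ).map e ≫ (twistReg σ).hom, ?_, ?_, rfl, ?_⟩
    · rw [Category.assoc, ← Functor.map_comp_assoc, h₁, CategoryTheory.Functor.map_id, Category.id_comp,
        Iso.inv_hom_id]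
    · rw [Category.assoc, Iso.hom_inv_id_assoc, ← Functor.map_comp, h₂, CategoryTheory.Functor.map_id]
    · rw [Ext.mk₀_comp_mk₀, Ext.mk₀_comp_mk₀, Ext.mapExactFunctor_mk₀, Ext.mk₀_comp_mk₀,
        Category.comp_id, Category.comp_id]
  | cons x l ih =>
    obtain ⟨M₀, π₀, m, η₀, f, g, w, ex, hn, k, hf, rfl, rfl⟩ := h
    refine ⟨_, _, m, _, (twist σ).map f, (twist σ).map g,
      by rw [← Functor.map_comp, w, Functor.map_zero],
      ex.map_of_exact (twist σ), hn, ih k, ?_, ?_, ?_⟩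
    · have e : (twistReg σ).inv ≫ (twist σ).map (mulR x) =
          mulR (σ x) ≫ (twistReg σ).inv := by
        refine ModuleCat.hom_ext (LinearMap.ext fun s : S => ?_)
        change σ.symm s * x = σ.symm (s * σ x)
        rw [map_mul, RingEquiv.symm_apply_apply]
      rw [Category.assoc, ← Functor.map_comp, hf, Functor.map_comp, reassoc_of% e]
    · rw [Category.assoc, ← Functor.map_comp]
    · rw [Ext.mapExactFunctor_comp, Ext.mapExactFunctor_extClass]
      exact Ext.comp_assoc _ _ _ hn (add_zero m) (by omega)

/-- A semilinear automorphism of the pair `(M, π)` maps the Koszul class of `l` to that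
of `σ l`. -/
theorem Kos.map_extConj {l : List S} {M : Type w} [AddCommGroup M] [Module S M]
    {π : regMod S ⟶ ModuleCat.of S M} {n : ℕ}
    {η : Ext (ModuleCat.of S M) (regMod S) n} (h : Kos l (ModuleCat.of S M) π n η)
    (φ : M ≃+ M) (hφ : ∀ (r : S) (m : M), φ (r • m) = σ r • φ m)
    (hπ : ∀ s : S, φ (π.hom s) = π.hom (σ s)) :
    Kos (l.map σ) (ModuleCat.of S M) π n
      (extConj σ M S φ hφ σ.toAddEquiv (fun r x => map_mul σ r x) η) := by
  convert (h.map_twist σ).of_iso (twistIso σ M φ hφ) using 1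
  · rw [Category.assoc, Iso.eq_inv_comp]
    exact ModuleCat.hom_ext (LinearMap.ext fun s : S => (hπ s).symm)
  · rfl

end Twist

/-! ### Change of basis and the determinant -/

section Determinant

variable {k : Type u} [Field k] {V : Type v} [AddCommGroup V] [Module k V]

variable (k) in
/-- A list of linearly independent vectors, without repetitions. -/
def LinIndepList (l : List V) : Prop := l.Nodup ∧ LinearIndepOn k id {x | x ∈ l}

theorem LinIndepList.perm {l l' : List V} (h : LinIndepList k l) (hp : l.Perm l') :
    LinIndepList k l' :=
  ⟨hp.nodup_iff.1 h.1, by simpa only [hp.mem_iff] using h.2⟩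

theorem linIndepList_cons {x : V} {l : List V} :
    LinIndepList k (x :: l) ↔ LinIndepList k l ∧ x ∉ Submodule.span k {y | y ∈ l} := by
  have e : {y | y ∈ x :: l} = insert x {y | y ∈ l} := by
    ext y
    simp
  rw [LinIndepList, LinIndepList, List.nodup_cons, e, linearIndepOn_id_insert_iff]
  constructor
  · rintro ⟨⟨h₁, h₂⟩, h₃, h₄⟩
    exact ⟨⟨h₂, h₃⟩, fun h => h₁ (h₄ h)⟩
  · rintro ⟨⟨h₁, h₂⟩, h₃⟩
    exact ⟨⟨fun h => h₃ (Submodule.subset_span h), h₁⟩, h₂, fun h => absurd h h₃⟩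

theorem linIndepList_ofFn {d : ℕ} {v : Fin d → V} (hv : LinearIndependent k v) :
    LinIndepList k (List.ofFn v) := by
  refine ⟨List.nodup_ofFn.2 hv.injective, ?_⟩
  have e : {x | x ∈ List.ofFn v} = Set.range v := by
    ext x
    simp [List.mem_ofFn]
  rw [e]
  exact hv.linearIndepOn_id

variable {S : Type w} [Ring S] [Algebra k S] (φ : V →ₗ[k] S)

theorem map_mem_ofList {l : List V} {x : V} (hx : x ∈ Submodule.span k {y | y ∈ l}) :
    φ x ∈ Ideal.ofList (l.map φ) := by
  induction hx using Submodule.span_induction with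
  | mem x h => exact Ideal.subset_span (List.mem_map_of_mem h)
  | zero => rw [map_zero]; exact zero_mem _
  | add x y _ _ hx hy => rw [map_add]; exact add_mem hx hy
  | smul c x _ hx =>
    rw [map_smul, Algebra.smul_def]
    exact Ideal.mul_mem_left _ _ hx

/-- A sign `b` (where `true` stands for `-1`) is not affected by a further divisor. -/
theorem kos_cons_congr {x : S} {l l' : List S} {b : Bool}
    (H : ∀ (M : ModuleCat.{w} S) (π : regMod S ⟶ M) (n : ℕ) (η : Ext M (regMod S) n),
      Kos l M π n η → Kos l' M π n (bif b then -η else η))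
    (M : ModuleCat.{w} S) (π : regMod S ⟶ M) (n : ℕ) (η : Ext M (regMod S) n)
    (h : Kos (x :: l) M π n η) : Kos (x :: l') M π n (bif b then -η else η) := by
  obtain ⟨M₀, π₀, m, η₀, f, g, w, ex, hn, k, hf, rfl, rfl⟩ := h
  refine ⟨M₀, π₀, m, _, f, g, w, ex, hn, H _ _ _ _ k, hf, rfl, ?_⟩
  cases b
  · rfl
  · exact (Ext.comp_neg _ _ _).symm

/-- Permuting a list multiplies the Koszul class by a sign, which is the same for all lists of
linearly independent vectors.  This is stated for the two lists of components of a list of pairs. -/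
theorem exists_sign_of_perm (hcomm : ∀ v w, Commute (φ v) (φ w))
    (hreg : ∀ l, LinIndepList k l → RightReg (l.map φ))
    {P P' : List (V × V)} (hP : P.Perm P')
    (h₁ : LinIndepList k (P.map Prod.fst)) (h₂ : LinIndepList k (P.map Prod.snd)) :
    ∃ b : Bool, (∀ (M : ModuleCat.{w} S) (π : regMod S ⟶ M) (n : ℕ) (η : Ext M (regMod S) n),
        Kos ((P.map Prod.fst).map φ) M π n η →
          Kos ((P'.map Prod.fst).map φ) M π n (bif b then -η else η)) ∧
      ∀ (M : ModuleCat.{w} S) (π : regMod S ⟶ M) (n : ℕ) (η : Ext M (regMod S) n),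
        Kos ((P.map Prod.snd).map φ) M π n η →
          Kos ((P'.map Prod.snd).map φ) M π n (bif b then -η else η) := by
  induction hP with
  | nil => exact ⟨false, fun _ _ _ _ h => h, fun _ _ _ _ h => h⟩
  | cons p _ ih =>
    rw [List.map_cons, linIndepList_cons] at h₁ h₂
    obtain ⟨b, hb₁, hb₂⟩ := ih h₁.1 h₂.1
    exact ⟨b, kos_cons_congr hb₁, kos_cons_congr hb₂⟩
  | swap p q l =>
    have key : ∀ (x y : V) (l : List V), LinIndepList k (y :: x :: l) →
        ∀ (M : ModuleCat.{w} S) (π : regMod S ⟶ M) (n : ℕ) (η : Ext M (regMod S) n),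
        Kos ((y :: x :: l).map φ) M π n η → Kos ((x :: y :: l).map φ) M π n (-η) := by
      intro x y l hl M π n η h
      have hr := hreg _ (hl.perm (List.Perm.swap x y l))
      refine h.swap (hcomm x y) ?_ ?_ hr.2.1 hr.1
      · simpa using fun z _ => (hcomm z x).eq
      · simpa using fun z _ => (hcomm z y).eq
    exact ⟨true, key _ _ _ h₁, key _ _ _ h₂⟩
  | trans hP _ ih ih' =>
    obtain ⟨b, hb₁, hb₂⟩ := ih h₁ h₂
    obtain ⟨b', hb₁', hb₂'⟩ := ih' (h₁.perm (hP.map _)) (h₂.perm (hP.map _))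
    refine ⟨xor b b', fun M π n η h => ?_, fun M π n η h => ?_⟩
    · have := hb₁' _ _ _ _ (hb₁ _ _ _ _ h)
      revert this
      cases b <;> cases b' <;> simp
    · have := hb₂' _ _ _ _ (hb₂ _ _ _ _ h)
      revert this
      cases b <;> cases b' <;> simp

/-- Replacing one vector `v i` by `c • v i` modulo the other ones divides the Koszul class by `c`.
The vector is moved to the head of the list and back; the two signs that arise are the same for `v`
and for `v'`, so they cancel. -/
theorem kos_update (hcomm : ∀ v w, Commute (φ v) (φ w))
    (hreg : ∀ l, LinIndepList k l → RightReg (l.map φ))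
    {d : ℕ} {v v' : Fin d → V} (hv : LinearIndependent k v)
    (hv' : LinearIndependent k v') (i : Fin d) {c : k} (hc : c ≠ 0) (hne : ∀ j ≠ i, v' j = v j)
    (hi : v' i - c • v i ∈ Submodule.span k (v '' {j | j ≠ i}))
    {M : ModuleCat.{w} S} {π : regMod S ⟶ M} {n : ℕ} {η : Ext M (regMod S) n}
    (h : Kos ((List.ofFn v).map φ) M π n η) :
    Kos ((List.ofFn v').map φ) M π n (extMulR η (algebraMap k S c⁻¹)) := by
  obtain _ | d := d
  · exact i.elim0
  set τ := Equiv.swap 0 i with hτ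
  let P : Fin (d + 1) → V × V := fun j => (v j, v' j)
  have hperm : (List.ofFn P).Perm (List.ofFn (P ∘ τ)) := (Equiv.Perm.ofFn_comp_perm τ P).symm
  have f₁ : (List.ofFn P).map Prod.fst = List.ofFn v := by rw [List.map_ofFn]; rfl
  have f₂ : (List.ofFn P).map Prod.snd = List.ofFn v' := by rw [List.map_ofFn]; rfl
  have g₁ : (List.ofFn (P ∘ τ)).map Prod.fst = v i :: List.ofFn (fun j : Fin d => v (τ j.succ)) := by
    rw [List.map_ofFn, List.ofFn_succ]
    simp [P, hτ]
  have hτi : ∀ j : Fin d, τ j.succ ≠ i := fun j hj => by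
    have : τ j.succ = τ 0 := by rw [hj, hτ, Equiv.swap_apply_left]
    exact Fin.succ_ne_zero j (τ.injective this)
  have g₂ : (List.ofFn (P ∘ τ)).map Prod.snd = v' i :: List.ofFn (fun j : Fin d => v (τ j.succ)) := by
    rw [List.map_ofFn, List.ofFn_succ]
    simp [P, hτ]
    funext j
    exact hne _ (hτi j)
  have l₁ := linIndepList_ofFn hv
  have l₂ := linIndepList_ofFn hv'
  obtain ⟨b, hb, -⟩ := exists_sign_of_perm φ hcomm hreg hperm (by rwa [f₁]) (by rwa [f₂])
  obtain ⟨b', hb₁', hb₂'⟩ := exists_sign_of_perm φ hcomm hreg hperm.symm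
    (by rw [← f₁] at l₁; exact l₁.perm (hperm.map _)) (by rw [← f₂] at l₂; exact l₂.perm (hperm.map _))
  rw [f₁, g₁] at hb hb₁'
  rw [f₂, g₂] at hb₂'
  have k₁ := hb _ _ _ _ h
  have k₂ := (hb₁' _ _ _ _ k₁).unique h
  rw [List.map_cons] at k₁
  have k₃ := k₁.scale_head (x' := φ (v' i)) (c := algebraMap k S c) (c' := algebraMap k S c⁻¹)
    (fun s => Algebra.commutes c s) (by rw [← map_mul, inv_mul_cancel₀ hc, map_one])
    (by rw [← map_mul, mul_inv_cancel₀ hc, map_one]) (by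
      rw [← Algebra.smul_def, ← map_smul, ← map_sub]
      refine map_mem_ofList φ (Submodule.span_mono ?_ hi)
      rintro _ ⟨j, hj, rfl⟩
      have : ∃ j' : Fin d, τ j'.succ = j := by
        obtain ⟨j', rfl⟩ := τ.surjective j
        have : j' ≠ 0 := by
          rintro rfl
          exact hj (Equiv.swap_apply_left 0 i)
        obtain ⟨j'', rfl⟩ := Fin.exists_succ_eq.2 this
        exact ⟨j'', rfl⟩
      obtain ⟨j', rfl⟩ := this
      exact List.mem_ofFn.2 ⟨j', rfl⟩)
  have k₄ := hb₂' _ _ _ _ k₃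
  convert k₄ using 1
  conv_lhs => rw [← k₂]
  cases b <;> cases b' <;> simp only [cond_true, cond_false, extMulR, Ext.neg_comp]

/-- The family `∑ⱼ Cᵢⱼ vⱼ`. -/
def matComb {d : ℕ} (C : Matrix (Fin d) (Fin d) k) (v : Fin d → V) : Fin d → V :=
  fun i => ∑ j, C i j • v j

theorem sum_smul_matComb {d : ℕ} (C : Matrix (Fin d) (Fin d) k) (v : Fin d → V) (a : Fin d → k) :
    ∑ i, a i • matComb C v i = ∑ j, (Matrix.vecMul a C) j • v j := by
  simp only [matComb, Finset.smul_sum, Matrix.vecMul, dotProduct, Finset.sum_smul, smul_smul]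
  exact Finset.sum_comm

theorem matComb_mul {d : ℕ} (C D : Matrix (Fin d) (Fin d) k) (v : Fin d → V) :
    matComb (C * D) v = matComb C (matComb D v) := by
  funext i
  exact (sum_smul_matComb D v (C i)).symm

theorem linearIndependent_matComb {d : ℕ} {C : Matrix (Fin d) (Fin d) k} (hC : C.det ≠ 0)
    {v : Fin d → V} (hv : LinearIndependent k v) : LinearIndependent k (matComb C v) := by
  rw [Fintype.linearIndependent_iff] at hv ⊢
  intro a ha
  rw [sum_smul_matComb] at ha
  exact fun i => congrFun (Matrix.eq_zero_of_vecMul_eq_zero hC (funext (hv _ ha))) i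

/-- The Koszul class is divided by the determinant under a change of basis. -/
theorem kos_matComb (hcomm : ∀ v w, Commute (φ v) (φ w))
    (hreg : ∀ l, LinIndepList k l → RightReg (l.map φ))
    {d : ℕ} {C : Matrix (Fin d) (Fin d) k} (hC : C.det ≠ 0)
    {v : Fin d → V} (hv : LinearIndependent k v)
    {M : ModuleCat.{w} S} {π : regMod S ⟶ M} {n : ℕ} {η : Ext M (regMod S) n}
    (h : Kos ((List.ofFn v).map φ) M π n η) :
    Kos ((List.ofFn (matComb C v)).map φ) M π n (extMulR η (algebraMap k S C.det⁻¹)) := by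
  refine Matrix.diagonal_transvection_induction_of_det_ne_zero
    (fun C => ∀ {v : Fin d → V} (_ : LinearIndependent k v) {η : Ext M (regMod S) n},
      Kos ((List.ofFn v).map φ) M π n η → Kos ((List.ofFn (matComb C v)).map φ) M π n
        (extMulR η (algebraMap k S C.det⁻¹))) C hC ?_ ?_ ?_ hv h
  · intro D hD v hv η h
    -- the entries are multiplied by the entries of the matrix one after the other
    rw [Matrix.det_diagonal] at hD ⊢
    have hD' : ∀ i, D i ≠ 0 := fun i => Finset.prod_ne_zero_iff.1 hD i (Finset.mem_univ i)
    suffices H : ∀ s : Finset (Fin d),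
        Kos ((List.ofFn (fun i => (if i ∈ s then D i else 1) • v i)).map φ) M π n
          (extMulR η (algebraMap k S (∏ i ∈ s, D i)⁻¹)) by
      convert H Finset.univ using 4 with i
      rw [matComb, Finset.sum_eq_single i]
      · simp
      · intro j _ hj
        rw [Matrix.diagonal_apply_ne' _ hj, zero_smul]
      · simp
    have hli : ∀ s : Finset (Fin d),
        LinearIndependent k (fun i => (if i ∈ s then D i else 1) • v i) := fun s => by
      convert hv.units_smul (fun i => if i ∈ s then Units.mk0 (D i) (hD' i) else 1) using 1
      funext i
      by_cases hi : i ∈ s <;> simp [hi, Units.smul_def]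
    intro s
    induction s using Finset.induction_on with
    | empty => simpa [extMulR_one] using h
    | insert i s hi ih =>
      have := kos_update φ hcomm hreg (hli s) (hli (insert i s)) i (hD' i)
        (fun j hj => by simp [hj]) (by simp [hi]) ih
      rw [Finset.prod_insert hi, mul_inv, mul_comm, map_mul, ← extMulR_extMulR]
      exact this
  · intro t v hv η h
    have hC : t.toMatrix.det ≠ 0 := by
      rw [Matrix.TransvectionStruct.det]
      exact one_ne_zero
    obtain ⟨i, j, hij, c⟩ := t
    have e : ∀ a, matComb (Matrix.TransvectionStruct.toMatrix ⟨i, j, hij, c⟩) v a =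
        v a + if a = i then c • v j else 0 := by
      intro a
      simp only [matComb, Matrix.TransvectionStruct.toMatrix_mk, Matrix.transvection,
        Matrix.add_apply, Matrix.one_apply, add_smul, Finset.sum_add_distrib, ite_smul, one_smul,
        zero_smul, Finset.sum_ite_eq, Finset.mem_univ, if_true, Matrix.single_apply]
      congr 1
      by_cases ha : a = i
      · subst ha
        simp
      · simp [ha, Ne.symm ha]
    have := kos_update φ hcomm hreg hv (linearIndependent_matComb hC hv) i one_ne_zero
      (fun a ha => by rw [e, if_neg ha, add_zero]) (by
        rw [e, if_pos rfl, one_smul, add_sub_cancel_left]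
        exact Submodule.smul_mem _ _ (Submodule.subset_span ⟨j, hij.symm, rfl⟩)) h
    rwa [Matrix.TransvectionStruct.det]
  · intro A B hA hB ihA ihB v hv η h
    have := ihA (linearIndependent_matComb hB hv) (ihB hv h)
    rwa [extMulR_extMulR, ← map_mul, ← matComb_mul, ← mul_inv_rev, ← Matrix.det_mul] at this

/-- The Koszul class is divided by the determinant of an automorphism that is applied to the
vectors of a basis. -/
theorem kos_linearEquiv (hcomm : ∀ v w, Commute (φ v) (φ w))
    (hreg : ∀ l, LinIndepList k l → RightReg (l.map φ))
    {d : ℕ} (b : Module.Basis (Fin d) k V) (g : V ≃ₗ[k] V)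
    {M : ModuleCat.{w} S} {π : regMod S ⟶ M} {n : ℕ} {η : Ext M (regMod S) n}
    (h : Kos ((List.ofFn b).map φ) M π n η) :
    Kos ((List.ofFn (g ∘ b)).map φ) M π n
      (extMulR η (algebraMap k S (LinearMap.det g.toLinearMap)⁻¹)) := by
  have hdet : (LinearMap.toMatrix b b g.toLinearMap).transpose.det =
      LinearMap.det g.toLinearMap := by
    rw [Matrix.det_transpose, LinearMap.det_toMatrix]
  have := kos_matComb φ hcomm hreg (C := (LinearMap.toMatrix b b g.toLinearMap).transpose)
    (by rw [hdet]; exact (LinearEquiv.isUnit_det' g).ne_zero) b.linearIndependent h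
  rw [hdet] at this
  convert this using 4
  funext i
  simp only [matComb, Matrix.transpose_apply, LinearMap.toMatrix_apply]
  exact (b.sum_repr (g (b i))).symm

end Determinant

/-! ### Enveloping algebras of algebras with partial derivatives -/

section Regularity

theorem exists_pow_apply_add_eq_zero {k M : Type*} [Semiring k] [AddCommMonoid M] [Module k M]
    {D : M →ₗ[k] M} {a b : M} (ha : ∃ n : ℕ, (D ^ n) a = 0) (hb : ∃ n : ℕ, (D ^ n) b = 0) :
    ∃ n : ℕ, (D ^ n) (a + b) = 0 := by
  obtain ⟨n, hn⟩ := ha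
  obtain ⟨m, hm⟩ := hb
  refine ⟨n + m, ?_⟩
  rw [map_add, pow_add, Module.End.mul_apply, Module.End.mul_apply, hm, map_zero, add_zero,
    ← Module.End.mul_apply, ← pow_add, add_comm, pow_add, Module.End.mul_apply, hn, map_zero]

/-- If `D` is locally nilpotent, preserves the left ideal `I` and satisfies `[D, · x] = 1`, then right
multiplication by `x` is injective modulo `I` in characteristic zero. -/
theorem mem_of_mul_mem_of_derivation {k : Type u} [Field k] [CharZero k]
    {S : Type w} [Ring S] [Algebra k S] {I : Ideal S} {x : S} (hI : ∀ s ∈ I, s * x ∈ I) (D : S →ₗ[k] S) (hDI : ∀ s ∈ I, D s ∈ I)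
    (hD : ∀ s, D (s * x) = D s * x + s) (hnil : ∀ s, ∃ n : ℕ, (D ^ n) s = 0)
    {s : S} (hs : s * x ∈ I) :
    s ∈ I := by
  have hpow : ∀ n : ℕ, (D ^ n) (s * x) ∈ I := fun n => by
    induction n with
    | zero => exact hs
    | succ n ih => rw [pow_succ', Module.End.mul_apply]; exact hDI _ ih
  have hcomm : ∀ n : ℕ, (D ^ (n + 1)) (s * x) =
      (D ^ (n + 1)) s * x + ((n + 1 : ℕ) : k) • (D ^ n) s := fun n => by
    induction n with
    | zero => simp [hD]
    | succ n ih =>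
      rw [pow_succ' D (n + 1), Module.End.mul_apply, ih, map_add, hD, map_smul, Module.End.mul_apply,
        ← Module.End.mul_apply D (D ^ n), ← pow_succ', add_assoc]
      congr 1
      push_cast
      module
  -- downward induction on the power of `D`
  have hdesc : ∀ n : ℕ, (D ^ (n + 1)) s ∈ I → (D ^ n) s ∈ I := fun n h => by
    have h₁ := I.sub_mem (hpow (n + 1)) (hI _ h)
    rw [hcomm, add_sub_cancel_left] at h₁
    have h₂ := I.mul_mem_left (algebraMap k S ((n + 1 : ℕ) : k)⁻¹) h₁
    rwa [← Algebra.smul_def, smul_smul, inv_mul_cancel₀ (Nat.cast_ne_zero.2 n.succ_ne_zero),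
      one_smul] at h₂
  obtain ⟨n, hn⟩ := hnil s
  have : ∀ m : ℕ, (D ^ m) s ∈ I → s ∈ I := fun m => by
    induction m with
    | zero => exact id
    | succ m ih => exact fun h => ih (hdesc m h)
  exact this n (hn ▸ I.zero_mem)

end Regularity

section Enveloping

variable (k : Type u) [Field k] {A : Type w} [Ring A] [Algebra k A]
  {V : Type v} [AddCommGroup V] [Module k V]

theorem envTmul_add_left (a a' b : A) : envTmul k (a + a') b = envTmul k a b + envTmul k a' b :=
  TensorProduct.add_tmul a a' (op b)

theorem envTmul_add_right (a b b' : A) : envTmul k a (b + b') = envTmul k a b + envTmul k a b' :=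
  TensorProduct.tmul_add a (op b) (op b')

theorem envTmul_smul_left (c : k) (a b : A) : envTmul k (c • a) b = c • envTmul k a b :=
  TensorProduct.smul_tmul' c a (op b)

theorem envTmul_smul_right (c : k) (a b : A) : envTmul k a (c • b) = c • envTmul k a b :=
  TensorProduct.tmul_smul c a (op b)

theorem envTmul_one_one : envTmul k (1 : A) 1 = 1 := rfl

theorem env_smul_assoc (c : k) (r : Env k A) (a : A) : (c • r) • a = c • (r • a) := by
  induction r using env_induction with
  | zero => simp
  | tmul x y => rw [← envTmul_smul_left, envTmul_smul, envTmul_smul, smul_mul_assoc, smul_mul_assoc]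
  | add r s hr hs => rw [smul_add, add_smul, add_smul, smul_add, hr, hs]

variable {k}

/-- The linear map `v ↦ x v ⊗ 1 - 1 ⊗ x v`. -/
def envDiff (x : V →ₗ[k] A) : V →ₗ[k] Env k A where
  toFun v := envTmul k (x v) 1 - envTmul k 1 (x v)
  map_add' v w := by
    rw [map_add, envTmul_add_left, envTmul_add_right, add_sub_add_comm]
  map_smul' c v := by
    rw [map_smul, envTmul_smul_left, envTmul_smul_right, smul_sub, RingHom.id_apply]

theorem envDiff_apply (x : V →ₗ[k] A) (v : V) :
    envDiff x v = envTmul k (x v) 1 - envTmul k 1 (x v) := rfl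

theorem envDiff_smul_one (x : V →ₗ[k] A) (v : V) : envDiff x v • (1 : A) = 0 := by
  rw [envDiff_apply, sub_smul, envTmul_smul, envTmul_smul]
  simp

theorem envSwap_envDiff (x : V →ₗ[k] A) (v : V) : envSwap k A (envDiff x v) = op (-envDiff x v) := by
  rw [envDiff_apply, map_sub, envSwap_envTmul, envSwap_envTmul, ← MulOpposite.op_sub, neg_sub]

theorem envDiff_commute {x : V →ₗ[k] A} (hx : ∀ v w, Commute (x v) (x w)) (v w : V) :
    Commute (envDiff x v) (envDiff x w) := by
  have h := (hx v w).eq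
  simp only [commute_iff_eq, envDiff_apply, mul_sub, sub_mul, envTmul_mul, one_mul, mul_one, h]
  abel

variable (k A) in
theorem envSwap_envSwap (r : Env k A) : envSwap k A (envSwap k A r).unop = op r := by
  induction r using env_induction with
  | zero => simp
  | tmul a b => rw [envSwap_envTmul, unop_op, envSwap_envTmul]
  | add r s hr hs => rw [map_add, MulOpposite.unop_add, map_add, hr, hs, MulOpposite.op_add]

variable (k A) in
theorem envSwap_bijective : Function.Bijective (envSwap k A) := by
  constructor
  · intro r s h
    have := envSwap_envSwap k A r
    rw [h, envSwap_envSwap] at this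
    exact (op_injective this).symm
  · intro r
    exact ⟨(envSwap k A r.unop).unop, by rw [envSwap_envSwap, op_unop]⟩

/-- For a left ideal `K` of `Aᵉ`, the elements `a` of `A` with `1 ⊗ a ≡ a ⊗ 1` modulo `K`. -/
def balancedSubalgebra (K : Ideal (Env k A)) : Subalgebra k A where
  carrier := {a | envTmul k 1 a - envTmul k a 1 ∈ K}
  add_mem' {a b} ha hb := by
    change envTmul k 1 (a + b) - envTmul k (a + b) 1 ∈ K
    rw [envTmul_add_left, envTmul_add_right, add_sub_add_comm]
    exact K.add_mem ha hb
  mul_mem' {a b} ha hb := by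
    have h₁ := K.mul_mem_left (envTmul k 1 b) ha
    have h₂ := K.mul_mem_left (envTmul k a 1) hb
    rw [mul_sub, envTmul_mul, envTmul_mul] at h₁ h₂
    have := K.add_mem h₁ h₂
    simp only [one_mul, mul_one] at this
    rwa [sub_add_sub_cancel] at this
  algebraMap_mem' c := by
    change envTmul k 1 (algebraMap k A c) - envTmul k (algebraMap k A c) 1 ∈ K
    rw [Algebra.algebraMap_eq_smul_one, envTmul_smul_left, envTmul_smul_right, sub_self]
    exact K.zero_mem

theorem mem_balancedSubalgebra {K : Ideal (Env k A)} {a : A} :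
    a ∈ balancedSubalgebra K ↔ envTmul k 1 a - envTmul k a 1 ∈ K := Iff.rfl

/-- If `1 ⊗ a ≡ a ⊗ 1` modulo the left ideal `K` for all `a`, then `K` contains the kernel of
`Aᵉ → A`. -/
theorem mem_of_smul_one_eq_zero {K : Ideal (Env k A)} (hK : balancedSubalgebra K = ⊤) {r : Env k A}
    (hr : r • (1 : A) = 0) : r ∈ K := by
  have h : ∀ r : Env k A, r - envTmul k (r • (1 : A)) 1 ∈ K := fun r => by
    induction r using env_induction with
    | zero => rw [zero_smul, ← zero_smul k (0 : A), envTmul_smul_left, zero_smul, sub_zero]; exact K.zero_mem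
    | tmul a b =>
      have hb : b ∈ balancedSubalgebra K := hK ▸ Algebra.mem_top
      have := K.mul_mem_left (envTmul k a 1) (mem_balancedSubalgebra.1 hb)
      rw [mul_sub, envTmul_mul, envTmul_mul, one_mul, mul_one, mul_one] at this
      rwa [envTmul_smul, mul_one]
    | add r s hr hs =>
      rw [add_smul, envTmul_add_left, add_sub_add_comm]
      exact K.add_mem hr hs
  have := h r
  rwa [hr, ← zero_smul k (0 : A), envTmul_smul_left, zero_smul, sub_zero] at this

/-- The elements `x v` of `A` commute, and for each linear form `f` on `V` there is a locally
nilpotent operator on `A` that behaves like the derivative in the direction of `f` with respect to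
right multiplication by the elements `x v`. -/
structure HasPartials (x : V →ₗ[k] A) : Prop where
  comm : ∀ v w, Commute (x v) (x w)
  partials : ∀ f : Module.Dual k V, ∃ D : A →ₗ[k] A,
    (∀ a v, D (a * x v) = D a * x v + f v • a) ∧ ∀ a, ∃ n : ℕ, (D ^ n) a = 0

/-- The operators of `HasPartials`, extended to `Aᵉ` by letting them act on the left factor. -/
theorem HasPartials.env {x : V →ₗ[k] A} (hx : HasPartials x) (f : Module.Dual k V) :
    ∃ D : Env k A →ₗ[k] Env k A,
      (∀ r v, D (r * envDiff x v) = D r * envDiff x v + f v • r) ∧ ∀ r, ∃ n : ℕ, (D ^ n) r = 0 := by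
  obtain ⟨D, hD, hnil⟩ := hx.partials f
  let E : Env k A →ₗ[k] Env k A := LinearMap.rTensor (M := Aᵐᵒᵖ) D
  have hE : ∀ a b, E (envTmul k a b) = envTmul k (D a) b := fun a b => LinearMap.rTensor_tmul _ _ _ _
  refine ⟨E, fun r v => ?_, fun r => ?_⟩
  · induction r using env_induction with
    | zero => simp
    | tmul a b =>
      rw [envDiff_apply, mul_sub, envTmul_mul, envTmul_mul, map_sub, hE, hE, hE, mul_sub, envTmul_mul,
        envTmul_mul, mul_one, mul_one, one_mul, hD, envTmul_add_left, envTmul_smul_left]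
      abel
    | add r s hr hs => rw [add_mul, map_add, map_add, hr, hs, smul_add, add_mul]; abel
  · have hpow : ∀ (n : ℕ) a b, (E ^ n) (envTmul k a b) = envTmul k ((D ^ n) a) b := fun n a b => by
      induction n with
      | zero => rfl
      | succ n ih => rw [pow_succ', Module.End.mul_apply, ih, hE, pow_succ', Module.End.mul_apply]
    induction r using env_induction with
    | zero => exact ⟨0, map_zero _⟩
    | tmul a b =>
      obtain ⟨n, hn⟩ := hnil a
      exact ⟨n, by rw [hpow, hn, ← zero_smul k (0 : A), envTmul_smul_left, zero_smul]⟩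
    | add r s hr hs => exact exists_pow_apply_add_eq_zero hr hs

/-- The regularity of the sequences of elements `x v ⊗ 1 - 1 ⊗ x v`.  To divide by the first element,
differentiate in the direction of a linear form that is one at its vector and zero at the others. -/
theorem HasPartials.rightReg [CharZero k] {x : V →ₗ[k] A} (hx : HasPartials x) (l : List V)
    (hl : LinIndepList k l) : RightReg (l.map (envDiff x)) := by
  induction l with
  | nil => trivial
  | cons y l ih =>
    rw [linIndepList_cons] at hl
    refine ⟨fun s hs => ?_, ih hl.1⟩
    obtain ⟨f, hfy, hfl⟩ := Submodule.exists_dual_map_eq_bot_of_notMem hl.2 inferInstance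
    have hfl' : ∀ z ∈ l, f z = 0 := fun z hz => by
      have : f z ∈ (Submodule.span k {y | y ∈ l}).map f :=
        ⟨z, Submodule.subset_span hz, rfl⟩
      rwa [hfl, Submodule.mem_bot] at this
    obtain ⟨D, hD, hnil⟩ := hx.env ((f y)⁻¹ • f)
    refine mem_of_mul_mem_of_derivation (fun t ht => mul_mem_ofList
      (forall₂_self_of_commute ?_) ht) D ?_ ?_ hnil hs
    · intro z hz
      obtain ⟨v, -, rfl⟩ := List.mem_map.1 hz
      exact envDiff_commute hx.comm v y
    · clear ih hs hl hfl
      induction l with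
      | nil => simp
      | cons z l ih =>
        intro s hs
        rw [List.map_cons, mem_ofList_cons] at hs ⊢
        obtain ⟨t, ht⟩ := hs
        refine ⟨D t, ?_⟩
        have := ih (fun z hz => hfl' z (List.mem_cons_of_mem _ hz)) _ ht
        rw [map_sub, hD] at this
        simpa [hfl' z List.mem_cons_self] using this
    · intro s
      rw [hD, LinearMap.smul_apply, smul_eq_mul, inv_mul_cancel₀ hfy, one_smul]

theorem HasPartials.exists_kos [CharZero k] {x : V →ₗ[k] A} (hx : HasPartials x) {d : ℕ}
    {b : Fin d → V} (hb : LinearIndependent k b) {M : ModuleCat.{w} (Env k A)}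
    {π : regMod (Env k A) ⟶ M} (hπ : Function.Surjective π.hom)
    (hk : ∀ s : Env k A, π.hom s = 0 ↔ s ∈ Ideal.ofList ((List.ofFn b).map (envDiff x))) :
    ∃ η, Kos ((List.ofFn b).map (envDiff x)) M π d η := by
  have h := (hx.rightReg _ (linIndepList_ofFn hb)).exists_kos
    (List.pairwise_map.2 (List.pairwise_of_forall fun v w => envDiff_commute hx.comm v w)) hπ hk
  have e : ∀ n, n = ((List.ofFn b).map (envDiff x)).length →
      ∃ η, Kos ((List.ofFn b).map (envDiff x)) M π n η := by
    rintro _ rfl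
    exact h
  exact e d (by simp)

theorem HasPartials.ext_eq [CharZero k] {x : V →ₗ[k] A} (hx : HasPartials x) {d : ℕ}
    {b : Fin d → V} (hb : LinearIndependent k b) {M : ModuleCat.{w} (Env k A)}
    {π : regMod (Env k A) ⟶ M} {η : Ext M (regMod (Env k A)) d}
    (h : Kos ((List.ofFn b).map (envDiff x)) M π d η) :
    (∀ m, m ≠ d → ∀ ξ : Ext M (regMod (Env k A)) m, ξ = 0) ∧
    (∀ ξ : Ext M (regMod (Env k A)) d, ∃ r, ξ = extMulR η (envSwap k A r).unop) ∧
    ∀ r, extMulR η (envSwap k A r).unop = 0 ↔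
      r ∈ Ideal.ofList ((List.ofFn b).map (envDiff x)) := by
  refine h.ext_eq (envSwap k A) (envSwap_bijective k A) (hx.rightReg _ (linIndepList_ofFn hb))
    (List.pairwise_map.2 (List.pairwise_of_forall fun v w => envDiff_commute hx.comm v w)) ?_
  intro y hy
  obtain ⟨v, -, rfl⟩ := List.mem_map.1 hy
  exact envSwap_envDiff x v

variable (k A) in
/-- The surjection `Aᵉ → A`. -/
abbrev envMulMap : regMod (Env k A) ⟶ ModuleCat.of (Env k A) A :=
  ModuleCat.ofHom (LinearMap.toSpanSingleton (Env k A) A 1)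

theorem envMulMap_apply (r : Env k A) : (envMulMap k A).hom r = r • (1 : A) := rfl

variable (k A) in
theorem envMulMap_surjective : Function.Surjective (envMulMap k A).hom := fun a =>
  ⟨envTmul k a 1, by rw [envMulMap_apply, envTmul_smul, mul_one, mul_one]⟩

theorem ofList_smul_one (x : V →ₗ[k] A) {l : List V} {r : Env k A}
    (hr : r ∈ Ideal.ofList (l.map (envDiff x))) : r • (1 : A) = 0 := by
  have : Ideal.ofList (l.map (envDiff x)) ≤ LinearMap.ker (LinearMap.toSpanSingleton (Env k A) A 1) := by
    refine Ideal.span_le.2 fun y hy => ?_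
    obtain ⟨v, -, rfl⟩ := List.mem_map.1 hy
    exact envDiff_smul_one x v
  exact this hr

theorem envDiff_mem_ofList (x : V →ₗ[k] A) {d : ℕ} (b : Module.Basis (Fin d) k V) (v : V) :
    envDiff x v ∈ Ideal.ofList ((List.ofFn b).map (envDiff x)) := by
  refine map_mem_ofList _ ?_
  have e : {y | y ∈ List.ofFn b} = Set.range b := by
    ext y
    simp [List.mem_ofFn]
  rw [e, b.span_eq]
  trivial

/-- Two cyclic modules are isomorphic if their generators have the same annihilator. -/
theorem exists_equiv_of_ker_eq {R : Type*} [Ring R] {M N : Type*} [AddCommGroup M] [Module R M]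
    [AddCommGroup N] [Module R N] {m : M} {n : N} (hm : ∀ a : M, ∃ r : R, a = r • m)
    (hn : ∀ a : N, ∃ r : R, a = r • n) (h : ∀ r : R, r • m = 0 ↔ r • n = 0) :
    ∃ e : M ≃ₗ[R] N, ∀ r : R, e (r • m) = r • n := by
  let F := LinearMap.toSpanSingleton R M m
  let F' := LinearMap.toSpanSingleton R N n
  have hF : Function.Surjective F := fun a => (hm a).imp fun r hr => hr.symm
  have hF' : Function.Surjective F' := fun a => (hn a).imp fun r hr => hr.symm
  have hker : LinearMap.ker F = LinearMap.ker F' := by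
    ext r
    exact h r
  refine ⟨(F.quotKerEquivOfSurjective hF).symm ≪≫ₗ Submodule.quotEquivOfEq _ _ hker ≪≫ₗ
    F'.quotKerEquivOfSurjective hF', fun r => ?_⟩
  have : (F.quotKerEquivOfSurjective hF).symm (r • m) = Submodule.Quotient.mk r := by
    rw [LinearEquiv.symm_apply_eq]
    rfl
  simp only [LinearEquiv.trans_apply, this]
  rfl

theorem dualExt_smul_def {n : ℕ} (r : Env k A) (ξ : DualExt k A n) :
    r • ξ = (extMulR (S := Env k A) (M := ModuleCat.of (Env k A) A) ξ (envSwap k A r).unop :) := rfl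

theorem envSwap_envAut (g : A ≃ₐ[k] A) (r : Env k A) :
    (envSwap k A (envAut k g r)).unop = envAut k g (envSwap k A r).unop := by
  induction r using env_induction with
  | zero => simp
  | tmul a b => rw [envAut_envTmul, envSwap_envTmul, envSwap_envTmul, unop_op, unop_op, envAut_envTmul]
  | add r s hr hs =>
    rw [map_add, map_add, MulOpposite.unop_add, hr, hs, map_add, MulOpposite.unop_add, map_add]

theorem extConj_extMulR {S : Type w} [Ring S] (σ : S ≃+* S) {M : Type w} [AddCommGroup M] [Module S M]
    (φ : M ≃+ M) (hφ : ∀ (r : S) (m : M), φ (r • m) = σ r • φ m) {n : ℕ}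
    (ξ : Ext (ModuleCat.of S M) (regMod S) n) (s : S) :
    extConj σ M S φ hφ σ.toAddEquiv (fun r x => map_mul σ r x) (extMulR ξ s) =
      extMulR (extConj σ M S φ hφ σ.toAddEquiv (fun r x => map_mul σ r x) ξ) (σ s) := by
  have e : (twist σ).map (mulR s) ≫ (twistReg σ).hom = (twistReg σ).hom ≫ mulR (σ s) :=
    ModuleCat.hom_ext (LinearMap.ext fun t : S => map_mul σ t s)
  have inner : ((extMulR ξ s).mapExactFunctor (twist σ)).comp (Ext.mk₀ (twistReg σ).hom)
      (add_zero n) = extMulR ((ξ.mapExactFunctor (twist σ)).comp (Ext.mk₀ (twistReg σ).hom)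
      (add_zero n)) (σ s) := by
    rw [extMulR, extMulR, Ext.mapExactFunctor_comp, Ext.mapExactFunctor_mk₀,
      Ext.comp_assoc_of_third_deg_zero, Ext.mk₀_comp_mk₀, e, ← Ext.mk₀_comp_mk₀,
      ← Ext.comp_assoc_of_third_deg_zero]
  rw [extConj, extConj, inner, comp_extMulR]

theorem autAct_smul (g : A ≃ₐ[k] A) {n : ℕ} (r : Env k A) (ξ : DualExt k A n) :
    autAct k g (r • ξ) = envAut k g r • autAct k g ξ := by
  have := extConj_extMulR (envAut k g).toRingEquiv g.toRingEquiv.toAddEquiv (map_env_smul k g) ξ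
    (envSwap k A r).unop
  refine this.trans ?_
  rw [dualExt_smul_def, envSwap_envAut]
  rfl

/-- Van den Bergh duality for an algebra generated by commuting elements `x v` that admit partial
derivatives.  An automorphism that permutes the `x v` through `gV` acts on the generator
of `Extᵈ(A, Aᵉ)` by `det(gV)⁻¹`. -/
theorem HasPartials.dualExt [CharZero k] [FiniteDimensional k V] {x : V →ₗ[k] A} (hx : HasPartials x)
    (hgen : Algebra.adjoin k (Set.range x) = ⊤) :
    (∀ n, n ≠ Module.finrank k V → Subsingleton (DualExt k A n)) ∧
    ∃ e : DualExt k A (Module.finrank k V) ≃ₗ[Env k A] A, ∀ (g : A ≃ₐ[k] A) (gV : V ≃ₗ[k] V),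
      (∀ v, g (x v) = x (gV v)) →
      ∀ ξ, e (autAct k g ξ) = (LinearMap.det gV.toLinearMap)⁻¹ • g (e ξ) := by
  let b := Module.finBasis k V
  have hker : ∀ r : Env k A, (envMulMap k A).hom r = 0 ↔
      r ∈ Ideal.ofList ((List.ofFn b).map (envDiff x)) := by
    refine fun r => ⟨mem_of_smul_one_eq_zero ?_, ofList_smul_one x⟩
    rw [eq_top_iff, ← hgen, Algebra.adjoin_le_iff]
    rintro _ ⟨v, rfl⟩
    change envTmul k 1 (x v) - envTmul k (x v) 1 ∈ Ideal.ofList ((List.ofFn b).map (envDiff x))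
    rw [← neg_sub, ← envDiff_apply]
    exact neg_mem (envDiff_mem_ofList x b v)
  obtain ⟨η, hη⟩ := hx.exists_kos b.linearIndependent (envMulMap_surjective k A) hker
  obtain ⟨h₁, h₂, h₃⟩ := hx.ext_eq b.linearIndependent hη
  refine ⟨fun n hn => ⟨fun ξ ζ => (h₁ n hn ξ).trans (h₁ n hn ζ).symm⟩, ?_⟩
  let η' : DualExt k A (Module.finrank k V) := η
  obtain ⟨e, he⟩ := exists_equiv_of_ker_eq (R := Env k A) (m := η') (n := (1 : A)) h₂
    (fun a => ((envMulMap_surjective k A) a).imp fun r hr => hr.symm)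
    (fun r => (h₃ r).trans (hker r).symm)
  refine ⟨e, fun g gV hg ξ => ?_⟩
  obtain ⟨r, rfl⟩ : ∃ r : Env k A, ξ = r • η' := h₂ ξ
  have hact : autAct k g η' = algebraMap k (Env k A) (LinearMap.det gV.toLinearMap)⁻¹ • η' := by
    have k₁ := hη.map_extConj (envAut k g).toRingEquiv g.toRingEquiv.toAddEquiv (map_env_smul k g)
      (fun s => by
        change g (s • (1 : A)) = envAut k g s • (1 : A)
        rw [map_env_smul, map_one])
    have k₂ := kos_linearEquiv (envDiff x) (envDiff_commute hx.comm) hx.rightReg b gV hη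
    have hl : ((List.ofFn b).map (envDiff x)).map (envAut k g).toRingEquiv =
        (List.ofFn (gV ∘ b)).map (envDiff x) := by
      rw [List.map_map, List.map_ofFn, List.map_ofFn]
      congr 1
      funext i
      change envAut k g (envDiff x (b i)) = envDiff x (gV (b i))
      rw [envDiff_apply, map_sub, envAut_envTmul, envAut_envTmul, map_one, hg, envDiff_apply]
    rw [hl] at k₁
    refine (k₁.unique k₂).trans ?_
    rw [dualExt_smul_def, Algebra.algebraMap_eq_smul_one, ← envTmul_one_one, ← envTmul_smul_left,
      envSwap_envTmul, unop_op, envTmul_smul_left, envTmul_smul_right]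
  rw [autAct_smul, hact, smul_smul, he, he, map_env_smul, map_one, mul_smul,
    Algebra.algebraMap_eq_smul_one, env_smul_assoc, one_smul]
  exact (smul_comm _ _ _).symm

end Enveloping

/-! ### Polynomial algebras and symmetric algebras -/

section Polynomials

/-- The span of the variable in `k[x]`. -/
noncomputable def polyX (k : Type u) [Field k] : k →ₗ[k] Polynomial k :=
  LinearMap.toSpanSingleton k _ Polynomial.X

theorem polyX_apply (k : Type u) [Field k] (c : k) : polyX k c = c • Polynomial.X := rfl

theorem hasPartials_polyX (k : Type u) [Field k] : HasPartials (polyX k) where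
  comm v w := Commute.all _ _
  partials f := by
    refine ⟨f 1 • Polynomial.derivative, fun a v => ?_, fun a => ⟨a.natDegree + 1, ?_⟩⟩
    · have : f v = v * f 1 := by rw [← smul_eq_mul, ← map_smul, smul_eq_mul, mul_one]
      simp only [polyX_apply, LinearMap.smul_apply, Polynomial.derivative_mul, Polynomial.derivative_C,
        Polynomial.derivative_X, this, Polynomial.smul_eq_C_mul, map_mul]
      ring
    · rw [smul_pow, LinearMap.smul_apply, Module.End.pow_apply,
        Polynomial.iterate_derivative_eq_zero (Nat.lt_succ_self _), smul_zero]

theorem adjoin_range_polyX (k : Type u) [Field k] : Algebra.adjoin k (Set.range (polyX k)) = ⊤ := by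
  rw [eq_top_iff, ← Polynomial.adjoin_X]
  refine Algebra.adjoin_mono ?_
  rintro _ rfl
  exact ⟨1, by rw [polyX_apply, one_smul]⟩

variable (k : Type u) [Field k] (V : Type v) [AddCommGroup V] [Module k V]

theorem adjoin_range_ι : Algebra.adjoin k (Set.range (SymmetricAlgebra.ι k V)) = ⊤ := by
  rw [eq_top_iff]
  rintro a -
  induction a using SymmetricAlgebra.induction with
  | algebraMap r => exact Subalgebra.algebraMap_mem _ r
  | ι x => exact Algebra.subset_adjoin ⟨x, rfl⟩
  | mul a b ha hb => exact Subalgebra.mul_mem _ ha hb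
  | add a b ha hb => exact Subalgebra.add_mem _ ha hb

/-- The derivative of `S(V)` in the direction of a linear form on `V`. -/
theorem hasPartials_ι [FiniteDimensional k V] : HasPartials (SymmetricAlgebra.ι k V) where
  comm v w := Commute.all _ _
  partials f := by
    let b := Module.finBasis k V
    let e := SymmetricAlgebra.equivMvPolynomial b
    let D := MvPolynomial.mkDerivation k
      (fun i => (MvPolynomial.C (f (b i)) : MvPolynomial (Fin (Module.finrank k V)) k))
    have hD : ∀ v, D (e (SymmetricAlgebra.ι k V v)) = MvPolynomial.C (f v) := by
      intro v
      have : D.toLinearMap ∘ₗ e.toLinearMap ∘ₗ SymmetricAlgebra.ι k V =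
          (Algebra.linearMap k (MvPolynomial (Fin (Module.finrank k V)) k)) ∘ₗ f := b.ext fun i => by
        change D (e (SymmetricAlgebra.ι k V (b i))) = MvPolynomial.C (f (b i))
        rw [SymmetricAlgebra.equivMvPolynomial_ι_apply, MvPolynomial.mkDerivation_X]
      exact congr($this v)
    have hX : ∀ p i, D (p * MvPolynomial.X i) = D p * MvPolynomial.X i + f (b i) • p := by
      intro p i
      rw [D.leibniz, MvPolynomial.mkDerivation_X, smul_eq_mul, smul_eq_mul, MvPolynomial.smul_eq_C_mul]
      ring
    have hnil : ∀ p, ∃ n : ℕ, (D.toLinearMap ^ n) p = 0 := by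
      intro p
      induction p using MvPolynomial.induction_on with
      | C a => exact ⟨1, by rw [pow_one]; exact D.map_algebraMap a⟩
      | add p q hp hq => exact exists_pow_apply_add_eq_zero hp hq
      | mul_X p i hp =>
        obtain ⟨n, hn⟩ := hp
        induction n generalizing p with
        | zero =>
          obtain rfl : p = 0 := hn
          exact ⟨0, by rw [zero_mul, map_zero]⟩
        | succ n ih =>
          obtain ⟨m, hm⟩ : ∃ m : ℕ, (D.toLinearMap ^ m) (D p * MvPolynomial.X i + f (b i) • p) = 0 :=
            exists_pow_apply_add_eq_zero (ih (D p) (by rwa [pow_succ, Module.End.mul_apply] at hn))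
              ⟨n + 1, by rw [map_smul, hn, smul_zero]⟩
          refine ⟨m + 1, ?_⟩
          rw [← hX] at hm
          rw [pow_succ, Module.End.mul_apply]
          exact hm
    refine ⟨e.symm.toLinearMap ∘ₗ D.toLinearMap ∘ₗ e.toLinearMap, fun a v => ?_, fun a => ?_⟩
    · apply e.injective
      change e (e.symm (D (e (a * _)))) = e (e.symm (D (e a)) * _ + _)
      rw [AlgEquiv.apply_symm_apply, map_mul, D.leibniz, hD, map_add, map_mul, map_smul,
        AlgEquiv.apply_symm_apply, smul_eq_mul, smul_eq_mul, MvPolynomial.smul_eq_C_mul]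
      ring
    · obtain ⟨n, hn⟩ := hnil (e a)
      refine ⟨n, ?_⟩
      have : ∀ m : ℕ, ((e.symm.toLinearMap ∘ₗ D.toLinearMap ∘ₗ e.toLinearMap) ^ m) a =
          e.symm ((D.toLinearMap ^ m) (e a)) := fun m => by
        induction m with
        | zero => exact (e.symm_apply_apply a).symm
        | succ m ih =>
          rw [pow_succ', Module.End.mul_apply, ih, pow_succ', Module.End.mul_apply]
          change e.symm (D (e (e.symm _))) = _
          rw [AlgEquiv.apply_symm_apply]
          rfl
      rw [this, hn, map_zero]

end Polynomials

section Semiinvariants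

variable {k : Type u} [Field k] {A : Type w} [Ring A] [Algebra k A]

/-- A generator of the bimodule `A` is not in the kernel of a character of `A`. -/
theorem map_ne_zero_of_generator (ψ : A →ₐ[k] k) {a : A} {r : Env k A} (h : r • a = 1) : ψ a ≠ 0 := by
  intro h0
  have : ∀ r : Env k A, ψ (r • a) = 0 := fun r => by
    induction r using env_induction with
    | zero => rw [zero_smul, map_zero]
    | tmul x y => rw [envTmul_smul, map_mul, map_mul, h0, mul_zero, zero_mul]
    | add r s hr hs => rw [add_smul, map_add, hr, hs, add_zero]
  have h1 := this r
  rw [h, map_one] at h1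
  exact one_ne_zero h1

theorem algebraMapInv_symAut {k : Type u} [Field k] {V : Type v} [AddCommGroup V] [Module k V]
    (g : V ≃ₗ[k] V) (a : SymmetricAlgebra k V) :
    SymmetricAlgebra.algebraMapInv (symAut k V g a) = SymmetricAlgebra.algebraMapInv a := by
  have : SymmetricAlgebra.algebraMapInv.comp (symAut k V g).toAlgHom =
      (SymmetricAlgebra.algebraMapInv : SymmetricAlgebra k V →ₐ[k] k) := by
    apply SymmetricAlgebra.algHom_ext
    ext x
    change SymmetricAlgebra.algebraMapInv (symAut k V g (SymmetricAlgebra.ι k V x)) =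
      SymmetricAlgebra.algebraMapInv (SymmetricAlgebra.ι k V x)
    rw [symAut_ι, SymmetricAlgebra.algebraMapInv_ι, SymmetricAlgebra.algebraMapInv_ι]
  exact congr($this a)

end Semiinvariants

section SymmetricAlgebra

variable (k : Type u) [Field k] [CharZero k] (V : Type v) [AddCommGroup V] [Module k V]
    [FiniteDimensional k V] (G : Subgroup (V ≃ₗ[k] V))

theorem dualExt_polynomial (c : k) (g : Polynomial k ≃ₐ[k] Polynomial k)
    (hg : g Polynomial.X = Polynomial.C c * Polynomial.X) :
    (∀ n : ℕ, n ≠ 1 → Subsingleton (DualExt k (Polynomial k) n)) ∧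
      ∃ e : DualExt k (Polynomial k) 1 ≃ₗ[Env k (Polynomial k)] Polynomial k,
        ∀ ξ, e (autAct k g ξ) = c⁻¹ • g (e ξ) := by
  have hc : c ≠ 0 := by
    rintro rfl
    rw [map_zero, zero_mul, map_eq_zero_iff g g.injective] at hg
    exact Polynomial.X_ne_zero hg
  have h := (hasPartials_polyX k).dualExt (adjoin_range_polyX k)
  rw [Module.finrank_self] at h
  obtain ⟨h₁, e, he⟩ := h
  refine ⟨h₁, e, fun ξ => ?_⟩
  rw [he g (LinearEquiv.smulOfNeZero k k c hc) (fun v => ?_)]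
  · congr 2
    have : (LinearEquiv.smulOfNeZero k k c hc).toLinearMap = c • LinearMap.id := rfl
    rw [this, LinearMap.det_smul, Module.finrank_self, pow_one, LinearMap.det_id, mul_one]
  · rw [polyX_apply, map_smul, hg, polyX_apply, ← Polynomial.smul_eq_C_mul, smul_smul, mul_comm]
    rfl

theorem dualExt_symmetricAlgebra :
    (∀ n, n ≠ Module.finrank k V → Subsingleton (DualExt k (SymmetricAlgebra k V) n)) ∧
    ∃ e : DualExt k (SymmetricAlgebra k V) (Module.finrank k V)
        ≃ₗ[Env k (SymmetricAlgebra k V)] SymmetricAlgebra k V,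
      ∀ (g : V ≃ₗ[k] V) (ξ : DualExt k (SymmetricAlgebra k V) (Module.finrank k V)),
        e (autAct k (symAut k V g) ξ) = (LinearMap.det g.toLinearMap)⁻¹ • symAut k V g (e ξ) := by
  obtain ⟨h₁, e, he⟩ := (hasPartials_ι k V).dualExt (adjoin_range_ι k V)
  exact ⟨h₁, e, fun g ξ => he _ g (fun v => symAut_ι k V g v) ξ⟩

variable {V}

theorem dualExt_equiv_det :
    ∃ e : DualExt k (SymmetricAlgebra k V) (Module.finrank k V)
        ≃ₗ[Env k (SymmetricAlgebra k V)] (SymmetricAlgebra k V ⊗[k] k),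
      ∀ (g : G) (ξ : DualExt k (SymmetricAlgebra k V) (Module.finrank k V)),
        e (autAct k (symAut k V g) ξ) =
          TensorProduct.map (symAut k V g).toLinearMap (detInv G g) (e ξ) := by
  obtain ⟨-, e, he⟩ := dualExt_symmetricAlgebra k V
  let t : SymmetricAlgebra k V ≃ₗ[Env k (SymmetricAlgebra k V)] (SymmetricAlgebra k V ⊗[k] k) :=
    { (TensorProduct.rid k (SymmetricAlgebra k V)).symm with
      map_smul' := fun r a => by
        change (r • a) ⊗ₜ[k] (1 : k) = r • (a ⊗ₜ[k] (1 : k))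
        rw [TensorProduct.smul_tmul'] }
  have ht : ∀ a, t a = a ⊗ₜ[k] (1 : k) := fun a => rfl
  refine ⟨e.trans t, fun g ξ => ?_⟩
  rw [LinearEquiv.trans_apply, LinearEquiv.trans_apply, he, ht, ht, TensorProduct.map_tmul,
    detInv_apply, mul_one, TensorProduct.smul_tmul, smul_eq_mul, mul_one]
  rfl

theorem dualExt_equiv_iff :
    (∃ e : DualExt k (SymmetricAlgebra k V) (Module.finrank k V)
        ≃ₗ[Env k (SymmetricAlgebra k V)] SymmetricAlgebra k V,
      ∀ (g : G) (ξ : DualExt k (SymmetricAlgebra k V) (Module.finrank k V)),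
        e (autAct k (symAut k V g) ξ) = symAut k V g (e ξ)) ↔
      ∀ g ∈ G, LinearEquiv.det g = 1 := by
  obtain ⟨-, e, he⟩ := dualExt_symmetricAlgebra k V
  constructor
  · rintro ⟨e', he'⟩ g hg
    -- the image of the generator of `Ext` is semi-invariant, and its constant term is not zero
    set ξ₀ := e.symm 1 with hξ₀
    have h₁ : autAct k (symAut k V g) ξ₀ =
        algebraMap k (Env k (SymmetricAlgebra k V)) (LinearMap.det g.toLinearMap)⁻¹ • ξ₀ := by
      apply e.injective
      rw [he, map_smul, hξ₀, e.apply_symm_apply, map_one, Algebra.algebraMap_eq_smul_one, env_smul_assoc,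
        one_smul]
    have h₂ := he' ⟨g, hg⟩ ξ₀
    rw [h₁, map_smul, Algebra.algebraMap_eq_smul_one, env_smul_assoc, one_smul] at h₂
    let ε : SymmetricAlgebra k V →ₐ[k] k := SymmetricAlgebra.algebraMapInv
    have hne : ε (e' ξ₀) ≠ 0 := by
      obtain ⟨r, hr⟩ := envMulMap_surjective k (SymmetricAlgebra k V) (e (e'.symm 1))
      rw [envMulMap_apply] at hr
      refine map_ne_zero_of_generator ε (r := r) ?_
      rw [← map_smul, ← e'.eq_symm_apply]
      apply e.injective
      rw [map_smul, hξ₀, e.apply_symm_apply, hr]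
    have h₃ := congrArg ε h₂
    rw [map_smul, algebraMapInv_symAut, smul_eq_mul, mul_eq_right₀ hne, inv_eq_one] at h₃
    ext
    rw [LinearEquiv.coe_det, h₃, Units.val_one]
  · intro h
    refine ⟨e, fun g ξ => ?_⟩
    rw [he, ← LinearEquiv.coe_det, h g g.2, Units.val_one, inv_one, one_smul]

end SymmetricAlgebra

/-! ### Algebras generated by commuting elements and a finite group -/

section TwistedBimodule

variable {k : Type u} [Field k] {A : Type w} [Ring A] [Algebra k A]

/-- The automorphism `a ⊗ b ↦ a ⊗ τ b` of the enveloping algebra. -/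
noncomputable def envTwist (τ : A ≃ₐ[k] A) : Env k A ≃ₐ[k] Env k A :=
  (Algebra.TensorProduct.congr AlgEquiv.refl (AlgEquiv.op τ) : (A ⊗[k] Aᵐᵒᵖ) ≃ₐ[k] (A ⊗[k] Aᵐᵒᵖ))

theorem envTwist_envTmul (τ : A ≃ₐ[k] A) (a b : A) :
    envTwist τ (envTmul k a b) = envTmul k a (τ b) :=
  Algebra.TensorProduct.map_tmul _ _ a (op b)

/-- If `M` and `N` are `A` with the right action twisted by `τ` and by its inverse, then
`M ⊗_A N ≅ A`. -/
theorem tensorIsoSelf_of_twist (τ : A ≃ₐ[k] A) {M N : Type w} [AddCommGroup M] [Module (Env k A) M]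
    [AddCommGroup N] [Module (Env k A) N] (f : M ≃+ A) (f' : N ≃+ A)
    (hf : ∀ (r : Env k A) m, f (r • m) = envTwist τ r • f m)
    (hf' : ∀ (r : Env k A) n, f' (r • n) = envTwist τ.symm r • f' n) : TensorIsoSelf k A M N := by
  have hf₀ : ∀ a b m, f (envTmul k a b • m) = a * f m * τ b := fun a b m => by
    rw [hf, envTwist_envTmul, envTmul_smul]
  have hf₀' : ∀ a b n, f' (envTmul k a b • n) = a * f' n * τ.symm b := fun a b n => by
    rw [hf', envTwist_envTmul, envTmul_smul]
  let β : M →+ N →+ A := AddMonoidHom.mk' (fun m => AddMonoidHom.mk' (fun n => f m * τ (f' n))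
    (fun n n' => by rw [map_add, map_add, mul_add]))
    (fun m m' => AddMonoidHom.ext fun n => by
      change f (m + m') * _ = f m * _ + f m' * _
      rw [map_add, add_mul])
  let Φ : M ⊗[ℤ] N →+ A := TensorProduct.liftAddHom β fun c m n => by
    rw [map_zsmul, map_zsmul, AddMonoidHom.zsmul_apply]
  have hΦ : ∀ m n, Φ (m ⊗ₜ n) = f m * τ (f' n) := fun m n => rfl
  set R := Submodule.span ℤ {t : M ⊗[ℤ] N | ∃ (m : M) (a : A) (n : N),
    t = (envTmul k 1 a • m) ⊗ₜ[ℤ] n - m ⊗ₜ[ℤ] (envTmul k a 1 • n)} with hR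
  have hle : R ≤ LinearMap.ker Φ.toIntLinearMap := by
    refine Submodule.span_le.2 ?_
    rintro _ ⟨m, a, n, rfl⟩
    refine LinearMap.mem_ker.2 ?_
    change Φ ((envTmul k 1 a • m) ⊗ₜ[ℤ] n - m ⊗ₜ[ℤ] (envTmul k a 1 • n)) = 0
    rw [map_sub, hΦ, hΦ, hf₀, hf₀', map_one, mul_one, one_mul, map_mul, mul_assoc, sub_self]
  let F : BalancedTensor k A M N →ₗ[ℤ] A := R.liftQ Φ.toIntLinearMap hle
  have hF : ∀ t : M ⊗[ℤ] N, F (Submodule.Quotient.mk t) = Φ t := fun t => rfl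
  -- the inverse maps `a` to `m ⊗ n` with `f m = a` and `f' n = 1`
  let F' : A →+ BalancedTensor k A M N := AddMonoidHom.mk'
    (fun a => Submodule.Quotient.mk (f.symm a ⊗ₜ[ℤ] f'.symm 1)) (fun a b => by
      rw [map_add, TensorProduct.add_tmul, Submodule.Quotient.mk_add])
  have hF' : ∀ a, F' a = Submodule.Quotient.mk (f.symm a ⊗ₜ[ℤ] f'.symm 1) := fun a => rfl
  refine ⟨{ toFun := F, invFun := F', left_inv := ?_, right_inv := fun a => ?_, map_add' := map_add F },
    fun a b m n => ?_⟩
  · intro t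
    obtain ⟨t, rfl⟩ := Submodule.Quotient.mk_surjective _ t
    induction t using TensorProduct.induction_on with
    | zero => rw [Submodule.Quotient.mk_zero, map_zero, map_zero]
    | tmul m n =>
      rw [hF, hΦ, hF']
      have hm : f.symm (f m * τ (f' n)) = envTmul k 1 (f' n) • m := by
        rw [AddEquiv.symm_apply_eq, hf₀, one_mul]
      have hn : n = envTmul k (f' n) 1 • f'.symm 1 := by
        apply f'.injective
        rw [hf₀', f'.apply_symm_apply, map_one, mul_one, mul_one]
      rw [hm]
      conv_rhs => rw [hn]
      exact (Submodule.Quotient.eq _).2 (Submodule.subset_span ⟨m, f' n, f'.symm 1, rfl⟩)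
    | add s t hs ht => rw [Submodule.Quotient.mk_add, map_add, map_add, hs, ht]
  · rw [hF', hF, hΦ, f.apply_symm_apply, f'.apply_symm_apply, map_one, mul_one]
  · change F (Submodule.Quotient.mk ((envTmul k a 1 • m) ⊗ₜ[ℤ] (envTmul k 1 b • n))) =
      a * F (Submodule.Quotient.mk (m ⊗ₜ[ℤ] n)) * b
    rw [hF, hF, hΦ, hΦ, hf₀, hf₀', one_mul, map_one, mul_one, map_mul, τ.apply_symm_apply]
    simp only [mul_assoc]

/-- The twist of `A` by `τ` is invertible, the inverse being the twist by `τ⁻¹`. -/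
theorem isInvertibleBimodule_of_twist (τ : A ≃ₐ[k] A) {M : Type w} [AddCommGroup M]
    [Module (Env k A) M] (f : M ≃+ A) (hf : ∀ (r : Env k A) m, f (r • m) = envTwist τ r • f m) :
    IsInvertibleBimodule k A M := by
  obtain ⟨N, iN, mN, f', hf'⟩ : ∃ (N : Type w) (_ : AddCommGroup N) (_ : Module (Env k A) N)
      (f' : N ≃+ A), ∀ (r : Env k A) n, f' (r • n) = envTwist τ.symm r • f' n :=
    ⟨A, inferInstance, Module.compHom A (envTwist τ.symm).toRingEquiv.toRingHom, AddEquiv.refl A,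
      fun _ _ => rfl⟩
  exact ⟨N, iN, mN, tensorIsoSelf_of_twist τ f f' hf hf', tensorIsoSelf_of_twist τ.symm f' f hf' hf⟩

/-- A bimodule generated by an element with the annihilator of the generator of the twist of `A`
by `τ` is isomorphic to this twist. -/
theorem exists_twisted_equiv (τ : A ≃ₐ[k] A) {M : Type w} [AddCommGroup M] [Module (Env k A) M]
    {m : M} (hm : ∀ a : M, ∃ r : Env k A, a = r • m)
    (h : ∀ r : Env k A, r • m = 0 ↔ envTwist τ r • (1 : A) = 0) :
    ∃ f : M ≃+ A, f m = 1 ∧ ∀ (r : Env k A) a, f (r • a) = envTwist τ r • f a := by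
  obtain ⟨N, iN, mN, f', hf'⟩ : ∃ (N : Type w) (_ : AddCommGroup N) (_ : Module (Env k A) N)
      (f' : N ≃+ A), ∀ (r : Env k A) n, f' (r • n) = envTwist τ r • f' n :=
    ⟨A, inferInstance, Module.compHom A (envTwist τ).toRingEquiv.toRingHom, AddEquiv.refl A,
      fun _ _ => rfl⟩
  obtain ⟨e, he⟩ := exists_equiv_of_ker_eq (R := Env k A) hm (n := f'.symm 1) (fun a => by
    refine ⟨envTmul k (f' a) 1, f'.injective ?_⟩
    rw [hf', envTwist_envTmul, envTmul_smul, f'.apply_symm_apply, map_one τ, mul_one, mul_one])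
    (fun r => by rw [h, ← f'.map_eq_zero_iff, hf', f'.apply_symm_apply])
  refine ⟨e.toAddEquiv.trans f', ?_, fun r a => ?_⟩
  · change f' (e m) = 1
    have := he 1
    rw [one_smul, one_smul] at this
    rw [this, f'.apply_symm_apply]
  · change f' (e (r • a)) = _ • f' (e a)
    rw [map_smul, hf']

theorem map_mem_ofList_of_fixed {S : Type w} [Ring S] (F : S →+* S) {l : List S}
    (hF : ∀ y ∈ l, F y = y) {r : S} (hr : r ∈ Ideal.ofList l) : F r ∈ Ideal.ofList l := by
  induction l generalizing r with
  | nil =>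
    rw [Ideal.ofList_nil, Submodule.mem_bot] at hr ⊢
    rw [hr, map_zero]
  | cons y l ih =>
    rw [mem_ofList_cons] at hr ⊢
    obtain ⟨t, ht⟩ := hr
    refine ⟨F t, ?_⟩
    have := ih (fun z hz => hF z (List.mem_cons_of_mem _ hz)) ht
    rwa [map_sub, map_mul, hF y List.mem_cons_self] at this

end TwistedBimodule

section Crossed

theorem map_mul_inv {G B : Type*} [Group G] [Monoid B] (u : G →* B) (g : G) : u g * u g⁻¹ = 1 := by
  rw [← map_mul, mul_inv_cancel, map_one]

variable {k : Type u} [Field k] {V : Type v} [AddCommGroup V] [Module k V]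
  {G : Subgroup (V ≃ₗ[k] V)} {B : Type w} [Ring B] [Algebra k B]

/-- The algebra `B` is generated by elements `x v` that admit partial derivatives, and by units `u g`
with `u g * x v = x (g v) * u g`. -/
structure IsCrossed (x : V →ₗ[k] B) (u : G →* B) : Prop where
  hasPartials : HasPartials x
  mul_comm : ∀ g v, u g * x v = x ((g : V ≃ₗ[k] V) v) * u g
  adjoin_eq_top : Algebra.adjoin k (Set.range x ∪ Set.range u) = ⊤

/-- The element `u g ⊗ u g⁻¹` of the enveloping algebra. -/
def conjElt (u : G →* B) (g : G) : Env k B := envTmul k (u g) (u g⁻¹)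

variable {x : V →ₗ[k] B} {u : G →* B}

theorem IsCrossed.envDiff_mul (h : IsCrossed x u) (g : G) (v : V) :
    envDiff x ((g : V ≃ₗ[k] V) v) * conjElt u g = conjElt u g * envDiff x v := by
  have h' : u g⁻¹ * x ((g : V ≃ₗ[k] V) v) = x v * u g⁻¹ := by
    rw [h.mul_comm]
    congr 2
    exact (g : V ≃ₗ[k] V).symm_apply_apply v
  rw [envDiff_apply, envDiff_apply, conjElt, sub_mul, mul_sub, envTmul_mul, envTmul_mul, envTmul_mul,
    envTmul_mul, one_mul, mul_one, mul_one, one_mul, h', h.mul_comm g v]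

theorem conjElt_smul_one (u : G →* B) (g : G) : conjElt (k := k) u g • (1 : B) = 1 := by
  rw [conjElt, envTmul_smul, mul_one, map_mul_inv]

variable [Fintype G]

/-- The mean value of the elements `u g ⊗ u g⁻¹`. -/
def meanElt (u : G →* B) : Env k B := ∑ g, (Fintype.card G : k)⁻¹ • conjElt u g

theorem envTmul_mul_meanElt (u : G →* B) (h : G) :
    envTmul k 1 (u h) * meanElt u = envTmul k (u h) 1 * meanElt u := by
  rw [meanElt, Finset.mul_sum, Finset.mul_sum]
  refine (Fintype.sum_equiv (Equiv.mulLeft h) _ _ fun g => ?_).symm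
  rw [mul_smul_comm, mul_smul_comm, conjElt, conjElt, envTmul_mul, envTmul_mul, one_mul, mul_one,
    Equiv.coe_mulLeft, ← map_mul, ← map_mul, mul_inv_rev, inv_mul_cancel_right]

variable [CharZero k]

theorem card_ne_zero' : (Fintype.card G : k) ≠ 0 := Nat.cast_ne_zero.2 Fintype.card_ne_zero

theorem meanElt_smul_one (u : G →* B) : meanElt (k := k) u • (1 : B) = 1 := by
  rw [meanElt, Finset.sum_smul]
  simp only [env_smul_assoc, conjElt_smul_one]
  rw [Finset.sum_const, Finset.card_univ, ← Nat.cast_smul_eq_nsmul k, smul_smul,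
    mul_inv_cancel₀ card_ne_zero', one_smul]

variable {d : ℕ}

/-- An element `r` of `Bᵉ` annihilates `1 ∈ B` if and only if `r e` lies in the left ideal
generated by the elements `x v ⊗ 1 - 1 ⊗ x v`, where `e` is the mean value of the `u g ⊗ u g⁻¹`. -/
theorem IsCrossed.smul_one_eq_zero_iff (h : IsCrossed x u) (b : Module.Basis (Fin d) k V)
    (r : Env k B) : r • (1 : B) = 0 ↔
      r * meanElt u ∈ Ideal.ofList ((List.ofFn b).map (envDiff x)) := by
  set I := Ideal.ofList ((List.ofFn b).map (envDiff x)) with hI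
  constructor
  · let K : Ideal (Env k B) :=
      Submodule.comap (LinearMap.toSpanSingleton (Env k B) (Env k B) (meanElt u)) I
    have hmem : ∀ s, s ∈ K ↔ s * meanElt u ∈ I := fun s => Iff.rfl
    have hK : balancedSubalgebra K = ⊤ := by
      rw [eq_top_iff, ← h.adjoin_eq_top, Algebra.adjoin_le_iff]
      rintro _ (⟨v, rfl⟩ | ⟨g, rfl⟩)
      · change envTmul k 1 (x v) - envTmul k (x v) 1 ∈ K
        rw [← neg_sub, ← envDiff_apply, neg_mem_iff, hmem, meanElt, Finset.mul_sum]
        refine sum_mem fun g _ => ?_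
        have := h.envDiff_mul g ((g : V ≃ₗ[k] V).symm v)
        rw [LinearEquiv.apply_symm_apply] at this
        rw [mul_smul_comm, this, ← smul_mul_assoc]
        exact I.mul_mem_left _ (envDiff_mem_ofList x b _)
      · change envTmul k 1 (u g) - envTmul k (u g) 1 ∈ K
        rw [hmem, sub_mul, envTmul_mul_meanElt, sub_self]
        exact I.zero_mem
    exact fun hr => (hmem r).1 (mem_of_smul_one_eq_zero hK hr)
  · intro hr
    have := ofList_smul_one x hr
    rwa [mul_smul, meanElt_smul_one] at this

/-- Van den Bergh duality for `B`.  As a module over the enveloping algebra, `B` is a direct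
summand of `X = Bᵉ / ∑ Bᵉ (x v ⊗ 1 - 1 ⊗ x v)`, to which the Koszul classes apply.  The twist `τ`
multiplies `u g` by `det(g)`, because `u g ⊗ u g⁻¹` acts on the Koszul class of `X` by `det(g)⁻¹`. -/
theorem IsCrossed.dualExt (h : IsCrossed x u) [FiniteDimensional k V] (τ : B ≃ₐ[k] B)
    (hτx : ∀ v, τ (x v) = x v)
    (hτu : ∀ g : G, τ (u g) = LinearMap.det (g : V ≃ₗ[k] V).toLinearMap • u g) :
    HasProjectiveDimensionLE (ModuleCat.of (Env k B) B) (Module.finrank k V) ∧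
    (∀ n, n ≠ Module.finrank k V → Subsingleton (DualExt k B n)) ∧
    ∃ f : DualExt k B (Module.finrank k V) ≃+ B,
      ∀ (r : Env k B) ξ, f (r • ξ) = envTwist τ r • f ξ := by
  let b := Module.finBasis k V
  set l := (List.ofFn b).map (envDiff x) with hl
  obtain ⟨η, hη⟩ := h.hasPartials.exists_kos b.linearIndependent (quotMk_surjective l)
    (quotMk_eq_zero l)
  obtain ⟨h₁, h₂, h₃⟩ := h.hasPartials.ext_eq b.linearIndependent hη
  have := epi_of_surjective (quotMk_surjective l)
  have := epi_of_surjective (envMulMap_surjective k B)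
  -- `B` is a retract of `X`
  obtain ⟨i, hi⟩ := exists_desc (envMulMap_surjective k B) (mulR (meanElt u) ≫ quotMk l)
    (fun r hr => (quotMk_eq_zero l _).2 ((h.smul_one_eq_zero_iff b r).1 hr))
  obtain ⟨p, hp⟩ := exists_desc (quotMk_surjective l) (envMulMap k B)
    (fun r hr => ofList_smul_one x ((quotMk_eq_zero l r).1 hr))
  have hip : i ≫ p = 𝟙 _ := by
    rw [← cancel_epi (envMulMap k B), ← Category.assoc, hi, Category.assoc, hp, Category.comp_id]
    refine ModuleCat.hom_ext (LinearMap.ext fun r : Env k B => ?_)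
    change (r * meanElt u) • (1 : B) = r • (1 : B)
    rw [mul_smul, meanElt_smul_one]
  have hret : ∀ {n : ℕ} (ξ : Ext (ModuleCat.of (Env k B) B) (regMod (Env k B)) n),
      (Ext.mk₀ i).comp ((Ext.mk₀ p).comp ξ (zero_add n)) (zero_add n) = ξ := fun ξ => by
    rw [Ext.mk₀_comp_mk₀_assoc, hip, Ext.mk₀_id_comp]
  -- the effect on `η` of the projection of `X` to `B`
  let c : k := (Fintype.card G : k)⁻¹
  let δ : G → k := fun g => (LinearMap.det (g : V ≃ₗ[k] V).toLinearMap)⁻¹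
  have hδ : ∀ g, δ g * LinearMap.det (g : V ≃ₗ[k] V).toLinearMap = 1 := fun g =>
    inv_mul_cancel₀ (LinearEquiv.isUnit_det' _).ne_zero
  have hpi : (Ext.mk₀ (p ≫ i)).comp η (zero_add _) = extMulR η (∑ g, (δ g * c) • conjElt u g) := by
    -- `p ≫ i` is the mean value of the endomorphisms `φ g` of `X` that are induced by `u g ⊗ u g⁻¹`,
    -- and `φ g` multiplies `η` by `det(g)⁻¹ (u g ⊗ u g⁻¹)`
    have hfor : ∀ g, List.Forall₂ (fun y z => y * (c • conjElt u g) = (c • conjElt u g) * z)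
        ((List.ofFn ((g : V ≃ₗ[k] V) ∘ b)).map (envDiff x)) l := fun g => by
      rw [hl, ← List.map_ofFn, List.map_map, List.forall₂_map_left_iff, List.forall₂_map_right_iff]
      refine List.forall₂_same.2 fun v _ => ?_
      rw [mul_smul_comm, smul_mul_assoc]
      exact congrArg _ (h.envDiff_mul g v)
    have hk := fun g : G => kos_linearEquiv (envDiff x) (envDiff_commute h.hasPartials.comm)
      h.hasPartials.rightReg b (g : V ≃ₗ[k] V) hη
    choose φ hφ using fun g => exists_desc (quotMk_surjective l) (mulR (c • conjElt u g) ≫ quotMk l)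
      (fun r hr => (quotMk_eq_zero l _).2 (mul_mem_ofList (hfor g) (((hk g).ker.2 r).1 hr)))
    have hsum : p ≫ i = ∑ g, φ g := by
      rw [← cancel_epi (quotMk l), ← Category.assoc, hp, hi, Preadditive.comp_sum, meanElt, mulR_sum,
        Preadditive.sum_comp]
      exact Finset.sum_congr rfl fun g _ => (hφ g).symm
    have hφη : ∀ g, (Ext.mk₀ (φ g)).comp η (zero_add _) = extMulR η ((δ g * c) • conjElt u g) := by
      intro g
      rw [Kos.naturality (hfor g) (hk g) hη (hφ g), ← extMulR, extMulR_extMulR, mul_smul,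
        ← Algebra.smul_def]
    rw [hsum, Ext.mk₀_sum, Ext.sum_comp, extMulR_sum]
    exact Finset.sum_congr rfl fun g _ => hφη g
  have hret₀ : ∀ {n : ℕ} (ξ : Ext (ModuleCat.of (Env k B) B) (regMod (Env k B)) n),
      ξ = 0 ↔ (Ext.mk₀ p).comp ξ (zero_add n) = 0 := fun ξ =>
    ⟨fun h0 => by rw [h0, Ext.comp_zero], fun h0 => by rw [← hret ξ, h0, Ext.comp_zero]⟩
  have hpd := hη.hasProjectiveDimensionLT
  refine ⟨Retract.hasProjectiveDimensionLT ⟨i, p, hip⟩ _, fun n hn =>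
    ⟨fun ξ ξ' => ((hret₀ _).2 (h₁ n hn _)).trans ((hret₀ _).2 (h₁ n hn _)).symm⟩, ?_⟩
  -- the twist by the determinant turns the character idempotent of `p ≫ i` into the mean value
  let e' : Env k B := ∑ g, (δ g * c) • conjElt u g⁻¹
  have he' : ∑ g, (δ g * c) • conjElt u g = (envSwap k B e').unop := by
    have hswap : ∀ (a : k) (r : Env k B), (envSwap k B (a • r)).unop = a • (envSwap k B r).unop :=
      fun a r => by
        rw [Algebra.smul_def, Algebra.algebraMap_eq_smul_one, ← envTmul_one_one, ← envTmul_smul_left,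
          map_mul, envSwap_envTmul, MulOpposite.unop_mul, unop_op, envTmul_smul_right, envTmul_one_one,
          mul_smul_comm, mul_one]
    rw [map_sum, Finset.unop_sum]
    refine Finset.sum_congr rfl fun g _ => ?_
    rw [hswap, conjElt, conjElt, envSwap_envTmul, unop_op, inv_inv]
  have hτe : envTwist τ e' = meanElt u := by
    rw [map_sum, meanElt]
    refine Fintype.sum_equiv (Equiv.inv G) _ _ fun g => ?_
    rw [Equiv.inv_apply, map_smul, conjElt, inv_inv, envTwist_envTmul, hτu, envTmul_smul_right, smul_smul,
      mul_right_comm, hδ, one_mul]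
  have hfix : ∀ y ∈ l, envTwist τ y = y := fun y hy => by
    obtain ⟨v, -, rfl⟩ := List.mem_map.1 hy
    rw [envDiff_apply, map_sub, envTwist_envTmul, envTwist_envTmul, hτx, map_one]
  have hfix' : ∀ r, r ∈ Ideal.ofList l ↔ envTwist τ r ∈ Ideal.ofList l := fun r => by
    refine ⟨map_mem_ofList_of_fixed (envTwist τ).toRingEquiv.toRingHom hfix, fun hr => ?_⟩
    have := map_mem_ofList_of_fixed (envTwist τ).symm.toRingEquiv.toRingHom
      (fun y hy => ((envTwist τ).symm_apply_eq).2 (hfix y hy).symm) hr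
    exact ((envTwist τ).symm_apply_apply r) ▸ this
  -- the restriction of `η` to `B` generates `Ext`, and it has the annihilator of the generator `1` of
  -- the twist of `B`
  let ζ : DualExt k B (Module.finrank k V) := (Ext.mk₀ i).comp η (zero_add _)
  obtain ⟨f, -, hf⟩ := exists_twisted_equiv τ (m := ζ)
    (fun ξ => by
      obtain ⟨r, hr⟩ := h₂ ((Ext.mk₀ p).comp ξ (zero_add _))
      refine ⟨r, ?_⟩
      rw [← hret ξ, hr, comp_extMulR]
      rfl)
    (fun r => by
      rw [dualExt_smul_def, h.smul_one_eq_zero_iff b, ← hτe, ← map_mul, ← hfix', ← h₃]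
      refine (hret₀ _).trans ?_
      rw [comp_extMulR]
      rw [Ext.mk₀_comp_mk₀_assoc, hpi, extMulR_extMulR, he', map_mul, MulOpposite.unop_mul])
  exact ⟨f, hf⟩

end Crossed

/-! ### The crossed product -/

section CrossedDuality

variable {k : Type u} [Field k] {V : Type v} [AddCommGroup V] [Module k V]
  {G : Subgroup (V ≃ₗ[k] V)} {B : Type w} [Ring B] [Algebra k B] {x : V →ₗ[k] B} {u : G →* B}

/-- The twist of `B` by the determinant is isomorphic to `B` only if the determinant is trivial
on `G`: the image `w` of the generator satisfies `u g w (u g)⁻¹ = det(g)⁻¹ w`, and `w` is not in the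
kernel of a character of `B`. -/
theorem IsCrossed.nonempty_equiv_iff (h : IsCrossed x u) (τ : B ≃ₐ[k] B)
    (hτx : ∀ v, τ (x v) = x v)
    (hτu : ∀ g : G, τ (u g) = LinearMap.det (g : V ≃ₗ[k] V).toLinearMap • u g) (ψ : B →ₐ[k] k)
    {M : Type w} [AddCommGroup M] [Module (Env k B) M] (f : M ≃+ B)
    (hf : ∀ (r : Env k B) m, f (r • m) = envTwist τ r • f m) :
    Nonempty (M ≃ₗ[Env k B] B) ↔ ∀ g ∈ G, LinearEquiv.det g = 1 := by
  constructor
  · rintro ⟨F⟩ g hg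
    let γ : G := ⟨g, hg⟩
    set ζ := f.symm 1 with hζ
    set c := LinearMap.det (γ⁻¹ : V ≃ₗ[k] V).toLinearMap with hc
    have h₁ : conjElt u γ • ζ = (c • (1 : Env k B)) • ζ := by
      apply f.injective
      rw [hf, hf, hζ, f.apply_symm_apply, conjElt, envTwist_envTmul, hτu, envTmul_smul_right, map_smul,
        map_one, env_smul_assoc, env_smul_assoc, envTmul_smul, mul_one, map_mul_inv, one_smul]
      rfl
    have hne : ψ (F ζ) ≠ 0 := by
      refine map_ne_zero_of_generator ψ (r := (envTwist τ).symm (envTmul k (f (F.symm 1)) 1)) ?_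
      rw [← map_smul, ← F.eq_symm_apply]
      apply f.injective
      rw [hf, hζ, f.apply_symm_apply, AlgEquiv.apply_symm_apply, envTmul_smul, mul_one, mul_one]
    have h₂ := congrArg (fun m => ψ (F m)) h₁
    simp only [map_smul] at h₂
    rw [conjElt, envTmul_smul, env_smul_assoc, one_smul, map_smul, map_mul, map_mul, mul_right_comm,
      ← map_mul, map_mul_inv, map_one, one_mul, smul_eq_mul, eq_comm, mul_eq_right₀ hne] at h₂
    have h₃ : LinearEquiv.det g⁻¹ = 1 := by
      ext
      rw [LinearEquiv.coe_det, Units.val_one]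
      exact h₂
    rwa [map_inv, inv_eq_one] at h₃
  · intro hG
    have hτ : τ.toAlgHom = AlgHom.id k B := by
      refine AlgHom.ext_of_adjoin_eq_top h.adjoin_eq_top ?_
      rintro _ (⟨v, rfl⟩ | ⟨g, rfl⟩)
      · exact hτx v
      · refine (hτu g).trans ?_
        rw [← LinearEquiv.coe_det, hG g g.2, Units.val_one, one_smul]
        rfl
    have hτ' : ∀ r : Env k B, envTwist τ r = r := fun r => by
      induction r using env_induction with
      | zero => exact map_zero _
      | tmul a b => rw [envTwist_envTmul]; exact congrArg _ (congr($hτ b))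
      | add r s hr hs => rw [map_add, hr, hs]
    exact ⟨{ f with
      map_smul' := fun r m => by
        change f (r • m) = r • f m
        rw [hf, hτ'] }⟩

end CrossedDuality

section CrossedProduct

open SkewMonoidAlgebra

variable {k : Type u} [Field k] {V : Type v} [AddCommGroup V] [Module k V]
  (G : Subgroup (V ≃ₗ[k] V))

/-- The inclusion of `S(V)` into `S(V) # G`. -/
noncomputable def crossedIncl : SymmetricAlgebra k V →ₐ[k] CrossedProduct G :=
  { singleOneRingHom with commutes' := fun _ => rfl }

theorem crossedIncl_apply (a : SymmetricAlgebra k V) : crossedIncl G a = single 1 a := rfl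

/-- The inclusion of `V` into `S(V) # G`. -/
noncomputable def crossedι : V →ₗ[k] CrossedProduct G :=
  (crossedIncl G).toLinearMap ∘ₗ SymmetricAlgebra.ι k V

theorem crossedι_apply (v : V) : crossedι G v = single 1 (SymmetricAlgebra.ι k V v) := rfl

/-- The inclusion of `G` into `S(V) # G`. -/
noncomputable abbrev crossedOf : G →* CrossedProduct G := of (SymmetricAlgebra k V) G

theorem single_eq_mul (g : G) (a : SymmetricAlgebra k V) :
    single g a = crossedIncl G a * crossedOf G g := by
  rw [crossedIncl_apply, of_apply, single_mul_single, one_mul, one_smul, mul_one]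

theorem single_eq_mul' (g : G) (a : SymmetricAlgebra k V) :
    single g a = crossedOf G g * crossedIncl G (g⁻¹ • a) := by
  rw [crossedIncl_apply, of_apply, single_mul_single, mul_one, one_mul, smul_inv_smul]

theorem smul_ι (g : G) (v : V) :
    g • SymmetricAlgebra.ι k V v = SymmetricAlgebra.ι k V ((g : V ≃ₗ[k] V) v) :=
  symAut_ι k V g v

theorem crossedOf_mul_crossedι (g : G) (v : V) :
    crossedOf G g * crossedι G v = crossedι G ((g : V ≃ₗ[k] V) v) * crossedOf G g := by
  rw [crossedι_apply, crossedι_apply, of_apply, single_mul_single, single_mul_single, smul_ι, one_smul,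
    mul_one, one_mul, mul_one, one_mul]

/-- The linear endomorphism of `S(V) # G` that acts on the component of `g` by `φ g`. -/
noncomputable def crossedMap (φ : G → SymmetricAlgebra k V →ₗ[k] SymmetricAlgebra k V) :
    CrossedProduct G →ₗ[k] CrossedProduct G :=
  Finsupp.lsum k (fun g => lsingle k g ∘ₗ φ g) ∘ₗ (coeffLinearEquiv (S := k)).toLinearMap

theorem crossedMap_single (φ : G → SymmetricAlgebra k V →ₗ[k] SymmetricAlgebra k V) (g : G)
    (a : SymmetricAlgebra k V) : crossedMap G φ (single g a) = single g (φ g a) :=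
  Finsupp.sum_single_index (by simp)

theorem hasPartials_crossedι [FiniteDimensional k V] : HasPartials (crossedι G) where
  comm v w := (Commute.all (SymmetricAlgebra.ι k V v) _).map (crossedIncl G)
  partials f := by
    choose D hD hnil using (hasPartials_ι k V).partials
    -- as `single g a * x v = single g (a * x (g v))`, the form `f ∘ g⁻¹` acts on the component of `g`
    let φ := fun g : G => D (f ∘ₗ (g : V ≃ₗ[k] V).symm.toLinearMap)
    have hpow : ∀ n g a, (crossedMap G φ ^ n) (single g a) = single g ((φ g ^ n) a) := fun n g a => by
      induction n with
      | zero => rfl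
      | succ n ih =>
        rw [pow_succ', Module.End.mul_apply, ih, crossedMap_single, pow_succ', Module.End.mul_apply]
    refine ⟨crossedMap G φ, fun b v => ?_, fun b => ?_⟩
    · induction b using SkewMonoidAlgebra.induction_on with
      | zero => simp
      | single g a =>
        rw [crossedι_apply, single_mul_single, smul_ι, mul_one, crossedMap_single, crossedMap_single,
          single_mul_single, mul_one, smul_ι, hD, single_add, smul_single]
        congr 3
        exact congrArg f ((g : V ≃ₗ[k] V).symm_apply_apply v)
      | add b c hb hc => rw [add_mul, map_add, map_add, hb, hc, smul_add, add_mul]; abel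
    · induction b using SkewMonoidAlgebra.induction_on with
      | zero => exact ⟨0, rfl⟩
      | single g a =>
        obtain ⟨n, hn⟩ := hnil (f ∘ₗ (g : V ≃ₗ[k] V).symm.toLinearMap) a
        exact ⟨n, by rw [hpow, hn, single_zero]⟩
      | add b c hb hc => exact exists_pow_apply_add_eq_zero hb hc

theorem isCrossed_crossedι [FiniteDimensional k V] : IsCrossed (crossedι G) (crossedOf G) where
  hasPartials := hasPartials_crossedι G
  mul_comm := crossedOf_mul_crossedι G
  adjoin_eq_top := by
    rw [eq_top_iff]
    rintro b -
    induction b using SkewMonoidAlgebra.induction_on with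
    | zero => exact zero_mem _
    | single g a =>
      rw [single_eq_mul]
      refine mul_mem ?_ (Algebra.subset_adjoin (Or.inr ⟨g, rfl⟩))
      have : (Algebra.adjoin k (Set.range (SymmetricAlgebra.ι k V))).map (crossedIncl G) ≤
          Algebra.adjoin k (Set.range (crossedι G) ∪ Set.range (crossedOf G)) := by
        rw [AlgHom.map_adjoin]
        refine Algebra.adjoin_mono ?_
        rintro _ ⟨_, ⟨v, rfl⟩, rfl⟩
        exact Or.inl ⟨v, rfl⟩
      rw [adjoin_range_ι] at this
      exact this ⟨a, trivial, rfl⟩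
    | add b c hb hc => exact add_mem hb hc

/-- The endomorphism `a # g ↦ χ g • (a # g)` of `S(V) # G`, for a linear character `χ` of `G`. -/
noncomputable def crossedTwistHom (χ : G →* k) : CrossedProduct G →ₐ[k] CrossedProduct G :=
  liftNCAlgHom (crossedIncl G)
    { toFun := fun g => χ g • crossedOf G g
      map_one' := by rw [map_one, map_one, one_smul]
      map_mul' := fun g h => by rw [map_mul, map_mul, smul_mul_smul_comm] }
    (fun {a g} => by
      change crossedIncl G (g • a) * (χ g • crossedOf G g) = (χ g • crossedOf G g) * crossedIncl G a
      rw [mul_smul_comm, smul_mul_assoc, ← single_eq_mul, single_eq_mul', inv_smul_smul])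

theorem crossedTwistHom_single (χ : G →* k) (g : G) (a : SymmetricAlgebra k V) :
    crossedTwistHom G χ (single g a) = χ g • single g a := by
  refine (liftNC_single _ _ g a).trans ?_
  change crossedIncl G a * (χ g • crossedOf G g) = _
  rw [mul_smul_comm, ← single_eq_mul]

theorem crossedTwistHom_comp (χ χ' : G →* k) (h : ∀ g, χ g * χ' g = 1) :
    (crossedTwistHom G χ).comp (crossedTwistHom G χ') = AlgHom.id k _ := by
  refine AlgHom.toLinearMap_injective (lhom_ext fun g a => ?_)
  change crossedTwistHom G χ (crossedTwistHom G χ' (single g a)) = single g a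
  rw [crossedTwistHom_single, map_smul, crossedTwistHom_single, smul_smul, mul_comm, h, one_smul]

/-- The automorphism `a # g ↦ det(g) a # g` of `S(V) # G`. -/
noncomputable def crossedDet : CrossedProduct G ≃ₐ[k] CrossedProduct G :=
  AlgEquiv.ofAlgHom
    (crossedTwistHom G ((Units.coeHom k).comp ((LinearEquiv.det : (V ≃ₗ[k] V) →* kˣ).comp G.subtype)))
    (crossedTwistHom G ((Units.coeHom k).comp ((LinearEquiv.det⁻¹ : (V ≃ₗ[k] V) →* kˣ).comp G.subtype)))
    (crossedTwistHom_comp G _ _ fun g => Units.mul_inv (LinearEquiv.det (g : V ≃ₗ[k] V)))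
    (crossedTwistHom_comp G _ _ fun g => Units.inv_mul (LinearEquiv.det (g : V ≃ₗ[k] V)))

theorem crossedDet_crossedι (v : V) : crossedDet G (crossedι G v) = crossedι G v := by
  refine (crossedTwistHom_single G _ 1 _).trans ?_
  rw [map_one, one_smul, crossedι_apply]

theorem crossedDet_crossedOf (g : G) : crossedDet G (crossedOf G g) =
    LinearMap.det (g : V ≃ₗ[k] V).toLinearMap • crossedOf G g := by
  rw [of_apply]
  refine (crossedTwistHom_single G _ g 1).trans ?_
  rw [← LinearEquiv.coe_det]
  rfl

/-- The trivial character `a # g ↦ a(0)` of `S(V) # G`. -/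
noncomputable def crossedAug : CrossedProduct G →ₐ[k] k :=
  liftNCAlgHom SymmetricAlgebra.algebraMapInv (1 : G →* k) (fun {a g} => by
    rw [MonoidHom.one_apply, mul_one, one_mul]
    exact algebraMapInv_symAut (g : V ≃ₗ[k] V) a)

/-- `Bᵉ` is a finite module over `Aᵉ` for `B = A # G` and `A = S(V)`. -/
theorem isNoetherianRing_env [FiniteDimensional k V] [Finite G] :
    IsNoetherianRing (Env k (CrossedProduct G)) := by
  let A := SymmetricAlgebra k V
  let j : (A ⊗[k] Aᵐᵒᵖ) →ₐ[k] Env k (CrossedProduct G) :=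
    (Algebra.TensorProduct.map (crossedIncl G) (AlgHom.op (crossedIncl G)) :
      (A ⊗[k] Aᵐᵒᵖ) →ₐ[k] (CrossedProduct G ⊗[k] (CrossedProduct G)ᵐᵒᵖ))
  have hj : ∀ a b : A, j (a ⊗ₜ op b) = envTmul k (crossedIncl G a) (crossedIncl G b) := fun a b =>
    Algebra.TensorProduct.map_tmul _ _ a (op b)
  have : Algebra.FiniteType k A := Algebra.FiniteType.equiv inferInstance
    (SymmetricAlgebra.equivMvPolynomial (Module.finBasis k V)).symm
  have : Algebra.FiniteType k Aᵐᵒᵖ := Algebra.FiniteType.equiv this (AlgEquiv.toOpposite k A)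
  have : Algebra.FiniteType k (A ⊗[k] Aᵐᵒᵖ) :=
    Algebra.FiniteType.trans (S := A) inferInstance inferInstance
  have : IsNoetherianRing (A ⊗[k] Aᵐᵒᵖ) := Algebra.FiniteType.isNoetherianRing k _
  let mod : Module (A ⊗[k] Aᵐᵒᵖ) (Env k (CrossedProduct G)) :=
    Module.compHom (Env k (CrossedProduct G)) j.toRingHom
  have hsmul : ∀ (r : A ⊗[k] Aᵐᵒᵖ) (s : Env k (CrossedProduct G)), r • s = j r * s := fun _ _ => rfl
  have : IsScalarTower (A ⊗[k] Aᵐᵒᵖ) (Env k (CrossedProduct G)) (Env k (CrossedProduct G)) :=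
    ⟨fun r s t => mul_assoc (j r : Env k (CrossedProduct G)) s t⟩
  have : Module.Finite (A ⊗[k] Aᵐᵒᵖ) (Env k (CrossedProduct G)) := by
    let N : Submodule (A ⊗[k] Aᵐᵒᵖ) (Env k (CrossedProduct G)) :=
      Submodule.span _ (Set.range fun p : G × G => envTmul k (crossedOf G p.1) (crossedOf G p.2))
    have hN : ∀ b c, envTmul k b c ∈ N := by
      intro b c
      induction b using SkewMonoidAlgebra.induction_on with
      | zero => rw [← zero_smul k (0 : CrossedProduct G), envTmul_smul_left, zero_smul]; exact N.zero_mem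
      | add b b' hb hb' => rw [envTmul_add_left]; exact N.add_mem hb hb'
      | single g a =>
        induction c using SkewMonoidAlgebra.induction_on with
        | zero => rw [← zero_smul k (0 : CrossedProduct G), envTmul_smul_right, zero_smul]; exact N.zero_mem
        | add c c' hc hc' => rw [envTmul_add_right]; exact N.add_mem hc hc'
        | single h c =>
          rw [single_eq_mul, single_eq_mul', ← envTmul_mul, ← hj]
          exact N.smul_mem _ (Submodule.subset_span ⟨(g, h), rfl⟩)
    refine ⟨?_⟩
    have : N = ⊤ := by
      rw [eq_top_iff]
      rintro r -
      induction r using env_induction with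
      | zero => exact N.zero_mem
      | tmul b c => exact hN b c
      | add r s hr hs => exact N.add_mem hr hs
    rw [← this]
    exact Submodule.fg_span (Set.finite_range _)
  exact IsNoetherianRing.of_finite (A ⊗[k] Aᵐᵒᵖ) _

end CrossedProduct

/-! ### Finite free resolutions over Noetherian rings -/

section Resolution

variable {S : Type w} [Ring S] [IsNoetherianRing S]

variable (S) in
/-- A submodule of a finite free module is the image of a map from another one. -/
theorem exists_range_eq (K : Σ n : ℕ, Submodule S (Fin n → S)) :
    ∃ (m : ℕ) (f : (Fin m → S) →ₗ[S] (Fin K.1 → S)), LinearMap.range f = K.2 := by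
  obtain ⟨m, f, hf⟩ := Module.Finite.exists_fin' S K.2
  refine ⟨m, K.2.subtype ∘ₗ f, ?_⟩
  rw [LinearMap.range_comp, LinearMap.range_eq_top.2 hf, Submodule.map_top, Submodule.range_subtype]

/-- A finitely generated module over a Noetherian ring has a resolution by finitely generated free
modules. -/
theorem exists_finite_projectiveResolution (M : ModuleCat.{w} S) [Module.Finite S M] :
    ∃ P : ProjectiveResolution M, ∀ n, Module.Finite S (P.complex.X n) := by
  obtain ⟨m₀, π, hπ⟩ := Module.Finite.exists_fin' S M
  choose m f hf using exists_range_eq S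
  -- the ranks of the free modules and the kernels of the differentials
  let K : ℕ → Σ n : ℕ, Submodule S (Fin n → S) :=
    Nat.rec ⟨m₀, LinearMap.ker π⟩ fun _ K => ⟨m K, LinearMap.ker (f K)⟩
  let X : ℕ → ModuleCat.{w} S := fun n => ModuleCat.of S (Fin (K n).1 → S)
  let d : ∀ n, X (n + 1) ⟶ X n := fun n => ModuleCat.ofHom (f (K n))
  have hd : ∀ n y, (d n).hom y = 0 ↔ ∃ z, (d (n + 1)).hom z = y := fun n y => by
    have := hf (K (n + 1))
    exact (SetLike.ext_iff.1 this y).symm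
  have hπd : ∀ y : X 0, π y = 0 ↔ ∃ z, (d 0).hom z = y := fun y =>
    (SetLike.ext_iff.1 (hf (K 0)) y).symm
  have sq : ∀ n, d (n + 1) ≫ d n = 0 := fun n =>
    ModuleCat.hom_ext (LinearMap.ext fun z => (hd n _).2 ⟨z, rfl⟩)
  let p : X 0 ⟶ M := ModuleCat.ofHom π
  have hp : d 0 ≫ p = 0 := ModuleCat.hom_ext (LinearMap.ext fun z => (hπd _).2 ⟨z, rfl⟩)
  have hepi : Epi p := (ModuleCat.epi_iff_surjective p).2 hπ
  let C := ChainComplex.of X d sq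
  have hC : ∀ n, C.d (n + 1) n = d n := fun n => ChainComplex.of_d X d n
  let P : C ⟶ (ChainComplex.single₀ _).obj M :=
    (ChainComplex.toSingle₀Equiv C M).symm ⟨p, by rw [hC 0, hp]⟩
  have hP : P.f 0 = p := ChainComplex.toSingle₀Equiv_symm_apply_f_zero _ _
  have hproj : ∀ n, Projective (C.X n) := fun n =>
    ModuleCat.projective_of_free (Pi.basisFun S (Fin (K n).1))
  have hq : QuasiIso P := ⟨fun n => by
    cases n with
    | zero =>
      rw [ChainComplex.quasiIsoAt₀_iff, ShortComplex.quasiIso_iff_of_zeros']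
      · refine ⟨(ShortComplex.moduleCat_exact_iff _).2 fun y hy => ?_, ?_⟩
        · obtain ⟨z, hz⟩ := (hπd y).1 ((congr($(hP).hom y)).symm.trans hy)
          exact ⟨z, (congr($(hC 0).hom z)).trans hz⟩
        · change Epi (P.f 0)
          rw [hP]
          exact hepi
      all_goals rfl
    | succ n =>
      rw [quasiIsoAt_iff_exactAt' _ _ (ChainComplex.exactAt_succ_single_obj _ _)]
      rw [HomologicalComplex.exactAt_iff' _ (n + 1 + 1) (n + 1) n (by simp) (by simp)]
      refine (ShortComplex.moduleCat_exact_iff _).2 ?_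
      intro y hy
      have hy' : (d n).hom y = 0 := by
        rw [← hC]
        exact hy
      obtain ⟨z, hz⟩ := (hd n y).1 hy'
      exact ⟨z, (congr($(hC (n + 1)).hom z)).trans hz⟩⟩
  exact ⟨{ complex := C, π := P }, fun n => Module.Finite.pi⟩

end Resolution

end HochschildDuality

theorem mainTheorem5 (k : Type u) [Field k] [CharZero k] (V : Type v) [AddCommGroup V] [Module k V]
    [FiniteDimensional k V] (G : Subgroup (V ≃ₗ[k] V)) [Finite G] :
    -- the case of one variable, with `g` scaling the variable by `c`
    (∀ (c : k) (g : Polynomial k ≃ₐ[k] Polynomial k), g Polynomial.X = Polynomial.C c * Polynomial.X →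
      (∀ n : ℕ, n ≠ 1 → Subsingleton (DualExt k (Polynomial k) n)) ∧
      ∃ e : DualExt k (Polynomial k) 1 ≃ₗ[Env k (Polynomial k)] Polynomial k,
        ∀ ξ, e (autAct k g ξ) = c⁻¹ • g (e ξ)) ∧
    -- `Ext` of `A = S(V)`
    (∀ n : ℕ, n ≠ Module.finrank k V → Subsingleton (DualExt k (SymmetricAlgebra k V) n)) ∧
    (∃ e : DualExt k (SymmetricAlgebra k V) (Module.finrank k V)
        ≃ₗ[Env k (SymmetricAlgebra k V)] (SymmetricAlgebra k V ⊗[k] k),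
      ∀ (g : G) (ξ : DualExt k (SymmetricAlgebra k V) (Module.finrank k V)),
        e (autAct k (symAut k V g) ξ) =
          TensorProduct.map (symAut k V g).toLinearMap (detInv G g) (e ξ)) ∧
    -- `U_A ≅ A` as `Aᵉ # G`-modules
    ((∃ e : DualExt k (SymmetricAlgebra k V) (Module.finrank k V)
        ≃ₗ[Env k (SymmetricAlgebra k V)] SymmetricAlgebra k V,
      ∀ (g : G) (ξ : DualExt k (SymmetricAlgebra k V) (Module.finrank k V)),
        e (autAct k (symAut k V g) ξ) = symAut k V g (e ξ)) ↔
      ∀ g ∈ G, LinearEquiv.det g = 1) ∧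
    -- `S(V) # G`
    IsVdB k (CrossedProduct G) (Module.finrank k V) ∧
    (Nonempty (DualExt k (CrossedProduct G) (Module.finrank k V)
        ≃ₗ[Env k (CrossedProduct G)] CrossedProduct G) ↔
      ∀ g ∈ G, LinearEquiv.det g = 1) := by
  have := Fintype.ofFinite G
  have hB := isCrossed_crossedι G
  obtain ⟨hpd, hsub, f, hf⟩ := hB.dualExt (crossedDet G) (crossedDet_crossedι G)
    (crossedDet_crossedOf G)
  have := isNoetherianRing_env G
  have : Module.Finite (Env k (CrossedProduct G)) (CrossedProduct G) :=
    Module.Finite.of_surjective (envMulMap k (CrossedProduct G)).hom (envMulMap_surjective k _)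
  exact ⟨dualExt_polynomial k, (dualExt_symmetricAlgebra k V).1, dualExt_equiv_det k G,
    dualExt_equiv_iff k G,
    { resolution := exists_finite_projectiveResolution (ModuleCat.of (Env k (CrossedProduct G)) _)
      projectiveDimension := ⟨_, hpd⟩
      subsingleton_ext := hsub
      invertible := isInvertibleBimodule_of_twist (crossedDet G) f hf },
    hB.nonempty_equiv_iff (crossedDet G) (crossedDet_crossedι G) (crossedDet_crossedOf G)
      (crossedAug G) f hf⟩
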